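/- Setting. Fix $p\ge 1$ and a non-empty set $\mathbf S\subseteq\{1,\dots,p\}$ with $S=|\mathbf S|$. The training sample has size $n=2m$: the covariates $\mathbf x_1,\dots,\mathbf x_n\in\mathbb R^p$ are independent, $m$ of them uniform on $[0,\tfrac12]^p$ (cluster 1) and $m$ uniform on $[1,\tfrac32]^p$ (cluster 2). Outcomes are $Y_i=f(\mathbf x_i)+\varepsilon_i$ with $f(\mathbf x)=\mathbf x_{\mathbf S}^T\boldsymbol\beta_{\mathbf S}$, $\boldsymbol\beta_{\mathbf S}\sim N(0,I_{S\times S})$ and i.i.d. noise of mean zero and finite variance. The test point $\mathbf x_\star$ is uniform on $[0,\tfrac12]^p$ or on $[1,\tfrac32]^p$, each with probability $\tfrac12$. The test point, the covariates, the coefficients and the noise are independent. Centered trees. A random tree cuts each node at the midpoint of one of its sides, side $j$ being chosen with probability $p_{nj}$ independently of everything else, until $\lceil\log_2 k_n\rceil$ cuts have been made on every path, where $k_n>2$; $A_n(\mathbf x_\star,\theta)$ is the leaf containing $\mathbf x_\star$. A centered forest trained on the points with index in $D$ predicts $\sum_{i\in D}Y_iw_i$, where $$w_i=\mathbb E_\theta\Big[\frac{\mathbb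 1\{\mathbf x_i\in A_n(\mathbf x_\star,\theta)\}}{\sum_{l\in D}\mathbb 1\{\mathbf x_l\in A_n(\mathbf x_\star,\theta)\}}\Big]$$ and the quotient counts as $0$ when the leaf contains no training point. The Ensemble uses one forest per cluster, trained on that cluster with trees grown from its cube, and predicts at $\mathbf x_\star$ with the forest of the cluster whose cube contains $\mathbf x_\star$. The Merged learner is one forest trained on all $n$ points. Its leaf at $\mathbf x_\star$ is obtained by midpoint cuts either (a) of whichever of the two cubes contains $\mathbf x_\star$, or (b) of the whole range $[0,\tfrac32]^p$. Bias. If a learner gives training point $i$ the weight $w_i$ ($w_i=0$ for points it does not use), its squared bias is $\mathbb E_{\mathbf x_\star,\mathbf x_1,\dots,\mathbf x_n,\boldsymbol\beta}\big[\big(\mathbb E_\varepsilon[\sum_iY_iw_i]-f(\mathbf x_\star)\big)^2\big]$, and the leading term of the squared bias is $$\mathbb E_{\mathbf x_\star,\mathbf x_1,\dots,\mathbf x_n,\boldsymbol\beta}\Big[\sum_{i\ne l}w_i\,(f(\mathbf x_i)-f(\mathbf x_\star))\;w_l\,(f(\mathbf x_l)-f(\mathbf x_\star))\Big].$$ Theorem.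 Suppose that $p_{nj}\ge 0$, $\sum_jp_{nj}=1$, $p_{nj}=\tfrac1S(1+\xi_{nj})$ for $j\in\mathbf S$ and $p_{nj}=\xi_{nj}$ for $j\notin\mathbf S$, where $\xi_{nj}\to0$ for every $j$; let $p_n=\tfrac1S(1+\min_j\xi_{nj})$. Suppose that $p_{nj}\log k_n\to\infty$ for all $j=1,\dots,p$ and that $k_n/n\to0$ as $n\to\infty$. Then: (i) the leading term of the squared bias of the Ensemble is at most $\frac S8\,k_n^{\log_2(1-3p_n/4)}(1+o(1))$; (ii) the leading term of the squared bias of the Merged learner, in both versions (a) and (b), is at most $\frac S4\,k_n^{\log_2(1-3p_n/4)}(1+o(1))$, a bound twice as large. Moreover, the squared bias itself of each of these learners is at most the corresponding bound plus a term $O(e^{-n/(8k_n)})$, which accounts for leaves that contain no training point. -/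

import Mathlib

open MeasureTheory ProbabilityTheory Filter Topology

noncomputable section

namespace CenteredForest

/-! ### Centered trees -/

/-- An axis-parallel box `∏ j, [lo j, hi j)` in `ℝ^p`. -/
structure Box (p : ℕ) where
  lo : Fin p → ℝ
  hi : Fin p → ℝ

/-- The points of a box. -/
def Box.toSet {p : ℕ} (B : Box p) : Set (Fin p → ℝ) :=
  {y | ∀ j, B.lo j ≤ y j ∧ y j < B.hi j}

/-- The node `B` is cut at its midpoint along coordinate `j`; this is the child containing `x`. -/
def Box.child {p : ℕ} (B : Box p) (x : Fin p → ℝ) (j : Fin p) : Box p :=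
  if x j < (B.lo j + B.hi j) / 2 then
    ⟨B.lo, Function.update B.hi j ((B.lo j + B.hi j) / 2)⟩
  else
    ⟨Function.update B.lo j ((B.lo j + B.hi j) / 2), B.hi⟩

/-- The leaf containing `x` of the centered tree grown from `root`, when `θ` lists the coordinates
that are cut at the successive nodes on the path from the root to `x`. -/
def leaf {p M : ℕ} (root : Box p) (θ : Fin M → Fin p) (x : Fin p → ℝ) : Box p :=
  (List.ofFn θ).foldl (fun B j => B.child x j) root

/-- Expectation over the randomization of a tree of depth `M`, of a quantity that depends on the
tree only through the leaf of one fixed test point: the `M` coordinates cut on the path to that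
point are independent, coordinate `j` being chosen with probability `prob j`. -/
def treeExp {p : ℕ} (M : ℕ) (prob : Fin p → ℝ) (F : (Fin M → Fin p) → ℝ) : ℝ :=
  ∑ θ : Fin M → Fin p, (∏ t, prob (θ t)) * F θ

/-- The indicator function of a set. -/
def ind {α : Type*} (s : Set α) (y : α) : ℝ := s.indicator (fun _ => (1 : ℝ)) y

/-! ### Training data: two clusters of `m` points each -/

/-- Indices of the `n = 2 m` training points: a cluster label and a position in the cluster. -/
abbrev Idx (m : ℕ) : Type := Fin 2 × Fin m

/-- The left end point of the range of cluster `t`: `0` for the first, `1` for the second. -/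
def corner (t : Fin 2) : ℝ := ((t : ℕ) : ℝ)

/-- The cube `[0, 1/2]^p` (first cluster) or `[1, 3/2]^p` (second cluster). -/
def cube (p : ℕ) (t : Fin 2) : Set (Fin p → ℝ) :=
  {y | ∀ j, y j ∈ Set.Icc (corner t) (corner t + 1 / 2)}

/-- The same cube as a root node. -/
def cubeBox (p : ℕ) (t : Fin 2) : Box p :=
  ⟨fun _ => corner t, fun _ => corner t + 1 / 2⟩

/-- The uniform distribution on the cube of cluster `t`. -/
def unifCube (p : ℕ) (t : Fin 2) : Measure (Fin p → ℝ) :=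
  Measure.pi fun _ => cond (volume : Measure ℝ) (Set.Icc (corner t) (corner t + 1 / 2))

/-- The distribution of the training covariates: independent points, uniform on the cube of their
cluster. -/
def dataLaw (p m : ℕ) : Measure (Idx m → Fin p → ℝ) :=
  Measure.pi fun i => unifCube p i.1

/-- The distribution of the test point: the equal mixture of the two cluster distributions. -/
def testLaw (p : ℕ) : Measure (Fin p → ℝ) :=
  (1 / 2 : ENNReal) • unifCube p 0 + (1 / 2 : ENNReal) • unifCube p 1

/-- The distribution `N(0, I)` of the coefficients of the strong features. -/
def coefLaw {p : ℕ} (S : Finset (Fin p)) : Measure (S → ℝ) :=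
  Measure.pi fun _ => gaussianReal 0 1

/-- The sparse linear regression function `f(x) = x_S ⬝ β_S`. -/
def regFun {p : ℕ} (S : Finset (Fin p)) (β : S → ℝ) (x : Fin p → ℝ) : ℝ :=
  ∑ j : S, x j * β j

/-! ### Forests -/

/-- The weight which the centered forest, grown from `root` to depth `M` and trained on the points
with index in `D`, gives at the test point `x` to training point `i`:
`E_θ [ 1{X i ∈ A} / ∑_{l ∈ D} 1{X l ∈ A} ]`, where `A` is the leaf of `x`, and the quotient counts
as `0` when the leaf holds no training point (which is what division by zero gives). -/
def forestWeight {p m : ℕ} (M : ℕ) (prob : Fin p → ℝ) (root : Box p) (D : Finset (Idx m))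
    (X : Idx m → Fin p → ℝ) (x : Fin p → ℝ) (i : Idx m) : ℝ :=
  treeExp M prob fun θ =>
    if i ∈ D then ind (leaf root θ x).toSet (X i) / ∑ l ∈ D, ind (leaf root θ x).toSet (X l)
    else 0

/-- The indices of the training points in cluster `t`. -/
def cluster (m : ℕ) (t : Fin 2) : Finset (Idx m) := Finset.univ.filter fun i => i.1 = t

/-- The weights of the Ensemble: one forest is trained on each cluster, and the forest of cluster
`t` predicts exactly at the test points in the cube of that cluster. -/
def ensembleWeight {p m : ℕ} (M : ℕ) (prob : Fin p → ℝ)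
    (X : Idx m → Fin p → ℝ) (x : Fin p → ℝ) (i : Idx m) : ℝ :=
  ∑ t : Fin 2, ind (cube p t) x * forestWeight M prob (cubeBox p t) (cluster m t) X x i

/-- The weights of the Merged learner: one forest is trained on all points. Its trees are grown
from the node `root x`. -/
def mergedWeight {p m : ℕ} (M : ℕ) (prob : Fin p → ℝ) (root : (Fin p → ℝ) → Box p)
    (X : Idx m → Fin p → ℝ) (x : Fin p → ℝ) (i : Idx m) : ℝ :=
  forestWeight M prob (root x) Finset.univ X x i

open Classical in
/-- Trees whose partition refines the two cubes `[0, 1/2]^p` and `[1, 3/2]^p`: the node from which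
the leaf of `x` is obtained by midpoint cuts is the cube containing `x`, so that a side cut `K`
times has length `2^(-K-1)`. -/
def ownCubeRoot (p : ℕ) (x : Fin p → ℝ) : Box p :=
  if x ∈ cube p 0 then cubeBox p 0 else cubeBox p 1

/-- Trees grown from the whole range `[0, 3/2]^p` of the pooled data. -/
def rangeRoot (p : ℕ) (_x : Fin p → ℝ) : Box p :=
  ⟨fun _ => 0, fun _ => 3 / 2⟩

/-! ### Squared bias -/

/-- The squared bias of the predictor `∑ i, Y i * w X x i`, where `Y i = f(X i) + ε i` and the noise
variables are independent with law `ν`: the expectation, over the test point `x`, the covariates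
`X` and the coefficients `β`, of `(E_ε[prediction at x] - f(x))²`. -/
def squaredBias {p m : ℕ} (S : Finset (Fin p)) (ν : Measure ℝ)
    (w : (Idx m → Fin p → ℝ) → (Fin p → ℝ) → Idx m → ℝ) : ℝ :=
  ∫ x, ∫ X, ∫ β,
    ((∫ ε : Idx m → ℝ, ∑ i, (regFun S β (X i) + ε i) * w X x i ∂(Measure.pi fun _ => ν))
      - regFun S β x) ^ 2
    ∂(coefLaw S) ∂(dataLaw p m) ∂(testLaw p)

/-- The leading term of the squared bias: the expectation of
`∑_{i ≠ l} w_i (f(X i) - f(x)) w_l (f(X l) - f(x))`, that is, `n (n - 1)` times the expectation of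
the summand for a uniformly chosen ordered pair of distinct training points. -/
def leadingTerm {p m : ℕ} (S : Finset (Fin p))
    (w : (Idx m → Fin p → ℝ) → (Fin p → ℝ) → Idx m → ℝ) : ℝ :=
  ∫ x, ∫ X, ∫ β,
    ∑ i, ∑ l ∈ Finset.univ.erase i,
      (w X x i * (regFun S β (X i) - regFun S β x)) *
        (w X x l * (regFun S β (X l) - regFun S β x))
    ∂(coefLaw S) ∂(dataLaw p m) ∂(testLaw p)

/-- The number of cuts `⌈log₂ k⌉` on each path from the root to a leaf. -/
def depth (k : ℝ) : ℕ := ⌈Real.logb 2 k⌉₊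

/-- The rate `k ^ log₂(1 - 3 q / 4)`. -/
def rate (k q : ℝ) : ℝ := k ^ Real.logb 2 (1 - 3 * q / 4)

end CenteredForest

end

open CenteredForest

/-!
A forest averages its trees, so by Jensen's inequality the squared error of a forest is at most the
mean of the squared errors of its trees, and a single tree can be treated with elementary means.

After integrating out the coefficients, which are uncorrelated with unit variance
(`integral_sq_coef`), both the squared bias and (an upper bound of) its leading term become sums
over `j ∈ S` of squared linear functions of the weights (`integral_bias_eq`,
`integral_leading_le`). For a test point in cluster `t`, each of the three learners almost surely
uses the weights of one forest that is trained on cluster `t` only and grown from a cube `[a, b)^p`: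
midpoint cuts of the whole range separate the clusters with the first cut (`ensembleWeight_eq`,
`mergedWeight_ownCube_eq`, `mergedWeight_range_eq`).

Consider a tree in which coordinate `j` is cut `K` times. Side `j` of the leaf of the test point `x`
is the one-dimensional dyadic cell of `x j` at level `K` (`leaf_side`), of length
`(b - a) / 2 ^ K`. The training points in the leaf are independent and, in coordinate `j`, centred
at the centre of the part of the cell that the cluster covers. So the squared error of the tree is
at most the squared distance of `x j` to that centre, plus the squared length times the mean of
`1 / N`, where `N` is the number of points in the leaf (`integral_sq_average_le`). Averaged over
`x`, the first part is at most one twelfth of the squared length (`integral_centre_cell_sq_le`).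
Every leaf has mass at least `2 ^ (-M)`, where `M` is the depth of the trees (`leaf_mass`); for
cells of the whole range this holds because one third is not a dyadic number
(`unifSide_cell_range`). Since `k / n → 0`, the second part is eventually at most one thirty-sixth
of the squared length. The sum is one ninth of it, and as `K` is binomial, its mean is
`(b - a) ^ 2 / 9 * (1 - 3 p_j / 4) ^ M` (`treeExp_pow_cuts`), which is bounded by the rate
(`pow_depth_le_rate`). For `b - a = 3 / 2` the factor is exactly `1 / 4`; for `b - a = 1 / 2` it is
`1 / 36`. Leaves without training points contribute to the squared bias at most a constant times
`exp (-2 ^ (-M) m)` (`integral_emptyLeaf_le`).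
-/

namespace CenteredForest

/-! ### Dyadic cells of an interval -/

/-- The half of the interval `[I.1, I.2)` on the side of `u`. -/
noncomputable def cut (u : ℝ) (I : ℝ × ℝ) : ℝ × ℝ :=
  if u < (I.1 + I.2) / 2 then (I.1, (I.1 + I.2) / 2) else ((I.1 + I.2) / 2, I.2)

/-- End points of the cell around `u` after `K` midpoint cuts of `[a, b)`. -/
noncomputable def cell (a b : ℝ) (K : ℕ) (u : ℝ) : ℝ × ℝ := (cut u)^[K] (a, b)

/-- The centre of the part of the interval `[I.1, I.2)` that lies in `[c, d)`. -/
noncomputable def centre (c d : ℝ) (I : ℝ × ℝ) : ℝ := (max I.1 c + min I.2 d) / 2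

lemma cell_zero (a b u : ℝ) : cell a b 0 u = (a, b) := rfl

lemma cell_succ (a b : ℝ) (K : ℕ) (u : ℝ) :
    cell a b (K + 1) u =
      if u < (a + b) / 2 then cell a ((a + b) / 2) K u else cell ((a + b) / 2) b K u := by
  unfold cell
  rw [Function.iterate_succ_apply]
  by_cases h : u < (a + b) / 2 <;> simp [cut, h]

lemma cell_length (a b : ℝ) (K : ℕ) (u : ℝ) :
    (cell a b K u).2 - (cell a b K u).1 = (b - a) / 2 ^ K := by
  induction K generalizing a b with
  | zero => simp [cell_zero]
  | succ K ih =>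
    rw [cell_succ]
    split_ifs <;> rw [ih] <;> field_simp <;> ring

lemma cell_mem {a b : ℝ} (K : ℕ) {u : ℝ} (ha : a ≤ u) (hb : u < b) :
    (cell a b K u).1 ≤ u ∧ u < (cell a b K u).2 := by
  induction K generalizing a b with
  | zero => simp [cell_zero, ha, hb]
  | succ K ih =>
    rw [cell_succ]
    split_ifs with h
    · exact ih ha h
    · exact ih (not_lt.1 h) hb

lemma cell_subset {a b : ℝ} (hab : a ≤ b) (K : ℕ) (u : ℝ) :
    a ≤ (cell a b K u).1 ∧ (cell a b K u).2 ≤ b := by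
  induction K generalizing a b with
  | zero => simp [cell_zero]
  | succ K ih =>
    rw [cell_succ]
    split_ifs with h
    · have := ih (a := a) (b := (a + b) / 2) (by linarith)
      exact ⟨this.1, by linarith [this.2]⟩
    · have := ih (a := (a + b) / 2) (b := b) (by linarith)
      exact ⟨by linarith [this.1], this.2⟩

/-- The end points of the cells of level `K` lie on a grid of mesh `(b - a) / 2 ^ K`. -/
lemma cell_grid (a b : ℝ) (K : ℕ) (u : ℝ) :
    ∃ i : ℕ, (cell a b K u).1 = a + i * ((b - a) / 2 ^ K) := by
  induction K generalizing a b with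
  | zero => exact ⟨0, by simp [cell_zero]⟩
  | succ K ih =>
    rw [cell_succ]
    split_ifs with h
    · obtain ⟨i, hi⟩ := ih a ((a + b) / 2)
      refine ⟨i, ?_⟩
      rw [hi]; field_simp; ring
    · obtain ⟨i, hi⟩ := ih ((a + b) / 2) b
      refine ⟨i + 2 ^ K, ?_⟩
      rw [hi]; push_cast; field_simp; ring

lemma measurable_cell (a b : ℝ) (K : ℕ) : Measurable (cell a b K) := by
  induction K generalizing a b with
  | zero => exact measurable_const
  | succ K ih =>
    have : cell a b (K + 1) = fun u =>
        if u < (a + b) / 2 then cell a ((a + b) / 2) K u else cell ((a + b) / 2) b K u := by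
      funext u; exact cell_succ a b K u
    rw [this]
    exact Measurable.ite measurableSet_Iio (ih _ _) (ih _ _)

lemma measurable_centre_cell (a b c d : ℝ) (K : ℕ) :
    Measurable fun u => centre c d (cell a b K u) := by
  have h := measurable_cell a b K
  unfold centre
  fun_prop

lemma abs_centre_sub_le {I : ℝ × ℝ} {c d u : ℝ} (h1 : I.1 ≤ u) (h2 : u ≤ I.2)
    (h3 : c ≤ u) (h4 : u ≤ d) : |centre c d I - u| ≤ I.2 - I.1 := by
  have h5 : max I.1 c ≤ u := max_le h1 h3
  have h6 : u ≤ min I.2 d := le_min h2 h4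
  have h7 := le_max_left I.1 c
  have h8 := min_le_left I.2 d
  unfold centre
  rw [abs_le]
  constructor <;> linarith

lemma integrableOn_centre_cell_sq {a b c d : ℝ} (K : ℕ) :
    IntegrableOn (fun u => (centre c d (cell a b K u) - u) ^ 2) (Set.Ico a b ∩ Set.Ico c d) := by
  refine Measure.integrableOn_of_bounded (M := ((b - a) / 2 ^ K) ^ 2) ?_ ?_ ?_
  · exact ((measure_mono Set.inter_subset_left).trans_lt (by simp)).ne
  · exact (((measurable_centre_cell a b c d K).sub measurable_id).pow_const 2).aestronglyMeasurable
  · filter_upwards [ae_restrict_mem (measurableSet_Ico.inter measurableSet_Ico)] with u hu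
    have h := cell_mem K hu.1.1 hu.1.2
    have h' := abs_centre_sub_le h.1 h.2.le hu.2.1 hu.2.2.le
    rw [cell_length] at h'
    rw [Real.norm_eq_abs, abs_pow]
    exact pow_le_pow_left₀ (abs_nonneg _) h' 2

lemma setIntegral_Ico_centre_sub_sq (l r : ℝ) (h : l ≤ r) :
    ∫ u in Set.Ico l r, ((l + r) / 2 - u) ^ 2 = (r - l) ^ 3 / 12 := by
  rw [integral_Ico_eq_integral_Ioc, ← intervalIntegral.integral_of_le h,
    intervalIntegral.integral_comp_sub_left (fun u => u ^ 2), integral_pow]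
  norm_num
  ring

/-- The mean squared distance of a point to the centre of its cell is at most one twelfth of the
squared length of the cell: it is a variance of a uniform distribution, also for the cells that
stick out of `[c, d)`. -/
lemma setIntegral_centre_cell_sq_le {a b : ℝ} (hab : a ≤ b) (c d : ℝ) (K : ℕ) :
    ∫ u in Set.Ico a b ∩ Set.Ico c d, (centre c d (cell a b K u) - u) ^ 2
      ≤ ((b - a) / 2 ^ K) ^ 2 / 12 * volume.real (Set.Ico a b ∩ Set.Ico c d) := by
  induction K generalizing a b with
  | zero =>
    simp only [cell_zero, pow_zero, div_one, Set.Ico_inter_Ico, centre]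
    rcases le_total (max a c) (min b d) with h | h
    · rw [setIntegral_Ico_centre_sub_sq _ _ h, Real.volume_real_Ico_of_le h]
      have h1 : min b d - max a c ≤ b - a := by
        linarith [le_max_left a c, min_le_left b d]
      have h0 : 0 ≤ min b d - max a c := by linarith
      have := mul_le_mul_of_nonneg_right (pow_le_pow_left₀ h0 h1 2) h0
      nlinarith
    · rw [Set.Ico_eq_empty (not_lt.2 h)]
      simp
  | succ K ih =>
    set e := (a + b) / 2 with he
    have hae : a ≤ e := by rw [he]; linarith
    have heb : e ≤ b := by rw [he]; linarith
    have hU : Set.Ico a b ∩ Set.Ico c d =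
        (Set.Ico a e ∩ Set.Ico c d) ∪ (Set.Ico e b ∩ Set.Ico c d) := by
      rw [← Set.union_inter_distrib_right, Set.Ico_union_Ico_eq_Ico hae heb]
    have hdisj : Disjoint (Set.Ico a e ∩ Set.Ico c d) (Set.Ico e b ∩ Set.Ico c d) :=
      (Set.Ico_disjoint_Ico_same).mono Set.inter_subset_left Set.inter_subset_left
    have hmL : MeasurableSet (Set.Ico a e ∩ Set.Ico c d) :=
      measurableSet_Ico.inter measurableSet_Ico
    have hmR : MeasurableSet (Set.Ico e b ∩ Set.Ico c d) :=
      measurableSet_Ico.inter measurableSet_Ico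
    have hint := integrableOn_centre_cell_sq (a := a) (b := b) (c := c) (d := d) (K + 1)
    rw [hU] at hint ⊢
    rw [setIntegral_union hdisj hmR (hint.mono_set Set.subset_union_left)
      (hint.mono_set Set.subset_union_right),
      measureReal_union hdisj hmR
        ((measure_mono Set.inter_subset_left).trans_lt (by simp)).ne
        ((measure_mono Set.inter_subset_left).trans_lt (by simp)).ne]
    have hL : ∫ u in Set.Ico a e ∩ Set.Ico c d, (centre c d (cell a b (K + 1) u) - u) ^ 2
        = ∫ u in Set.Ico a e ∩ Set.Ico c d, (centre c d (cell a e K u) - u) ^ 2 := by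
      refine setIntegral_congr_fun hmL fun u hu => ?_
      have : u < (a + b) / 2 := hu.1.2
      simp only [cell_succ, if_pos this]
      rfl
    have hR : ∫ u in Set.Ico e b ∩ Set.Ico c d, (centre c d (cell a b (K + 1) u) - u) ^ 2
        = ∫ u in Set.Ico e b ∩ Set.Ico c d, (centre c d (cell e b K u) - u) ^ 2 := by
      refine setIntegral_congr_fun hmR fun u hu => ?_
      have : ¬ u < (a + b) / 2 := not_lt.2 hu.1.1
      simp only [cell_succ, if_neg this]
      rfl
    rw [hL, hR]
    have iL := ih hae
    have iR := ih heb
    have e1 : (e - a) / 2 ^ K = (b - a) / 2 ^ (K + 1) := by rw [he]; field_simp; ring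
    have e2 : (b - e) / 2 ^ K = (b - a) / 2 ^ (K + 1) := by rw [he]; field_simp; ring
    rw [e1] at iL
    rw [e2] at iR
    linarith

/-! ### The uniform distribution on one side of a cube -/

/-- The common law of the coordinates of the points of cluster `t`. -/
noncomputable def unifSide (t : Fin 2) : Measure ℝ :=
  cond (volume : Measure ℝ) (Set.Icc (corner t) (corner t + 1 / 2))

instance (t : Fin 2) : IsProbabilityMeasure (unifSide t) :=
  cond_isProbabilityMeasure_of_finite (by simp) (by simp)

lemma unifCube_eq (p : ℕ) (t : Fin 2) : unifCube p t = Measure.pi fun _ => unifSide t := rfl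

instance (p : ℕ) (t : Fin 2) : IsProbabilityMeasure (unifCube p t) := by
  rw [unifCube_eq]; infer_instance

instance (p m : ℕ) : IsProbabilityMeasure (dataLaw p m) := by
  unfold dataLaw; infer_instance

/-- The uniform law does not see the right end point. -/
lemma unifSide_eq (t : Fin 2) :
    unifSide t = (2 : ENNReal) • volume.restrict (Set.Ico (corner t) (corner t + 1 / 2)) := by
  unfold unifSide ProbabilityTheory.cond
  rw [restrict_Ico_eq_restrict_Icc]
  congr 1
  rw [Real.volume_Icc, add_sub_cancel_left, ← ENNReal.ofReal_inv_of_pos (by norm_num)]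
  norm_num

lemma integral_unifSide (t : Fin 2) (f : ℝ → ℝ) :
    ∫ u, f u ∂(unifSide t) = 2 * ∫ u in Set.Ico (corner t) (corner t + 1 / 2), f u := by
  rw [unifSide_eq, integral_smul_measure]
  simp

lemma ae_unifSide_mem (t : Fin 2) :
    ∀ᵐ u ∂(unifSide t), u ∈ Set.Ico (corner t) (corner t + 1 / 2) := by
  rw [unifSide_eq]
  exact Measure.ae_smul_measure (ae_restrict_mem measurableSet_Ico) _

lemma unifSide_real_Ico (t : Fin 2) (l r : ℝ)
    (h : max l (corner t) ≤ min r (corner t + 1 / 2)) :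
    (unifSide t).real (Set.Ico l r) = 2 * (min r (corner t + 1 / 2) - max l (corner t)) := by
  rw [unifSide_eq, measureReal_ennreal_smul_apply, measureReal_restrict_apply measurableSet_Ico,
    Set.Ico_inter_Ico, Real.volume_real_Ico_of_le h]
  simp

/-- The centre of `[l, r) ∩ [corner t, corner t + 1/2)` is the mean of the uniform law of the side
restricted to `[l, r)`. -/
lemma integral_indicator_sub_centre (t : Fin 2) (l r : ℝ) :
    ∫ u, (Set.Ico l r).indicator (fun u => u - centre (corner t) (corner t + 1 / 2) (l, r)) u
      ∂(unifSide t) = 0 := by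
  rw [integral_unifSide, setIntegral_indicator measurableSet_Ico, Set.inter_comm, Set.Ico_inter_Ico]
  unfold centre
  simp only []
  rcases le_total (max l (corner t)) (min r (corner t + 1 / 2)) with h | h
  · rw [integral_Ico_eq_integral_Ioc, ← intervalIntegral.integral_of_le h,
      intervalIntegral.integral_comp_sub_right (fun u => u), integral_id]
    ring
  · rw [Set.Ico_eq_empty (not_lt.2 h)]
    simp

lemma integral_centre_cell_sq_le {a b : ℝ} (t : Fin 2) (ha : a ≤ corner t)
    (hb : corner t + 1 / 2 ≤ b) (K : ℕ) :
    ∫ u, (centre (corner t) (corner t + 1 / 2) (cell a b K u) - u) ^ 2 ∂(unifSide t)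
      ≤ ((b - a) / 2 ^ K) ^ 2 / 12 := by
  have h := setIntegral_centre_cell_sq_le (a := a) (b := b) (by linarith) (corner t)
    (corner t + 1 / 2) K
  rw [Set.inter_eq_right.2 (Set.Ico_subset_Ico ha hb),
    Real.volume_real_Ico_of_le (by linarith)] at h
  rw [integral_unifSide]
  linarith

lemma integrable_centre_cell_sq {a b : ℝ} (t : Fin 2) (ha : a ≤ corner t)
    (hb : corner t + 1 / 2 ≤ b) (K : ℕ) :
    Integrable (fun u => (centre (corner t) (corner t + 1 / 2) (cell a b K u) - u) ^ 2)
      (unifSide t) := by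
  have h := integrableOn_centre_cell_sq (a := a) (b := b) (c := corner t) (d := corner t + 1 / 2) K
  rw [Set.inter_eq_right.2 (Set.Ico_subset_Ico ha hb)] at h
  rw [unifSide_eq]
  exact Integrable.smul_measure h (by simp)

/-- Cells of the own cube have mass `2 ^ (-K)`. -/
lemma unifSide_cell_own (t : Fin 2) (K : ℕ) {u : ℝ}
    (hu : u ∈ Set.Ico (corner t) (corner t + 1 / 2)) :
    (1 / 2 : ℝ) ^ K ≤ (unifSide t).real
      (Set.Ico (cell (corner t) (corner t + 1 / 2) K u).1
        (cell (corner t) (corner t + 1 / 2) K u).2) := by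
  have h1 := cell_subset (a := corner t) (b := corner t + 1 / 2) (by linarith) K u
  have h2 := cell_mem K hu.1 hu.2
  have h3 := cell_length (corner t) (corner t + 1 / 2) K u
  rw [unifSide_real_Ico, max_eq_left h1.1, min_eq_left h1.2, h3]
  · apply le_of_eq; rw [one_div, inv_pow]; field_simp; ring
  · rw [max_eq_left h1.1, min_eq_left h1.2]; linarith

/-- A cell of the range `[0, 3/2)` that contains a point of a cluster has mass at least `2 ^ (-K)`
for that cluster: the cluster ends at one third or two thirds of the range, which is never an end
point of a cell, so a cell holds at least one third of its length of the cluster. -/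
lemma unifSide_cell_range (t : Fin 2) (K : ℕ) {u : ℝ}
    (hu : u ∈ Set.Ico (corner t) (corner t + 1 / 2)) :
    (1 / 2 : ℝ) ^ K ≤ (unifSide t).real
      (Set.Ico (cell 0 (3 / 2) K u).1 (cell 0 (3 / 2) K u).2) := by
  have hc : 0 ≤ corner t ∧ corner t ≤ 1 := by fin_cases t <;> simp [corner]
  have h2 := cell_mem (a := 0) (b := 3 / 2) K (u := u) (by linarith [hu.1]) (by linarith [hu.2])
  have h3 := cell_length 0 (3 / 2) K u
  have h1 := cell_subset (a := 0) (b := 3 / 2) (by norm_num) K u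
  obtain ⟨i, hi⟩ := cell_grid 0 (3 / 2) K u
  rw [unifSide_real_Ico]
  swap
  · exact (max_le h2.1 hu.1).trans (le_min h2.2.le hu.2.le)
  generalize (cell 0 (3 / 2) K u).1 = l at *
  generalize (cell 0 (3 / 2) K u).2 = r at *
  have hP : (0 : ℝ) < (1 / 2) ^ K := by positivity
  have hinv : (2 : ℝ) ^ K * (1 / 2) ^ K = 1 := by rw [← mul_pow]; norm_num
  have h3' : r - l = 3 / 2 * (1 / 2 : ℝ) ^ K := by
    rw [h3, one_div, inv_pow]; ring
  have hi' : l = i * (3 / 2 * (1 / 2 : ℝ) ^ K) := by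
    rw [hi, one_div, inv_pow]; ring
  generalize hx : (1 / 2 : ℝ) ^ K = x at *
  have key : x / 2 ≤ min r (corner t + 1 / 2) - max l (corner t) := by
    rw [le_sub_iff_add_le, le_min_iff]
    fin_cases t
    · simp only [corner, Nat.cast_zero, zero_add] at hu ⊢
      rw [max_eq_left h1.1]
      refine ⟨by linarith, ?_⟩
      have hlt : (3 * i : ℝ) < 2 ^ K := by
        by_contra hcon
        push Not at hcon
        nlinarith [hu.2, h2.1]
      have hle : (3 * i + 1 : ℝ) ≤ 2 ^ K := by exact_mod_cast hlt
      nlinarith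
    · simp only [corner, Nat.cast_one] at hu ⊢
      have hr : r = (i + 1) * (3 / 2 * x) := by linarith
      have hlt : (2 * 2 ^ K : ℝ) < 3 * (i + 1) := by
        by_contra hcon
        push Not at hcon
        nlinarith [hu.1, h2.2]
      have hle : (2 * 2 ^ K + 1 : ℝ) ≤ 3 * (i + 1) := by exact_mod_cast hlt
      have h5 : x / 2 + 1 ≤ r := by nlinarith
      refine ⟨?_, ?_⟩
      · rw [← le_sub_iff_add_le', max_le_iff]
        constructor <;> linarith
      · rw [← le_sub_iff_add_le', max_le_iff]
        constructor <;> linarith [h1.2]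
  linarith

/-! ### Averages over independent points, of which a random number falls into a set -/

lemma ind_of_mem {α : Type*} {s : Set α} {y : α} (h : y ∈ s) : ind s y = 1 :=
  Set.indicator_of_mem h _

lemma ind_of_notMem {α : Type*} {s : Set α} {y : α} (h : y ∉ s) : ind s y = 0 :=
  Set.indicator_of_notMem h _

lemma ind_nonneg {α : Type*} (s : Set α) (y : α) : 0 ≤ ind s y := by
  by_cases h : y ∈ s <;> simp [ind_of_mem, ind_of_notMem, h]

lemma measurable_ind {α : Type*} [MeasurableSpace α] {s : Set α} (hs : MeasurableSet s) :
    Measurable (ind s) := measurable_const.indicator hs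

lemma integral_ind {α : Type*} [MeasurableSpace α] (μ : Measure α) {s : Set α}
    (hs : MeasurableSet s) : ∫ y, ind s y ∂μ = μ.real s := by
  unfold ind
  rw [integral_indicator_const _ hs]
  simp

section Independent

variable {ι α : Type*}

/-- A factor that depends on one point only splits off. -/
lemma integral_pi_mul_of_update [Fintype ι] [DecidableEq ι] [MeasurableSpace α] [Inhabited α]
    (μ : ι → Measure α)
    [∀ i, IsProbabilityMeasure (μ i)] (i : ι) {g : α → ℝ} (hg : Measurable g)
    {h : (ι → α) → ℝ} (hh : Measurable h) (hupd : ∀ X y, h (Function.update X i y) = h X) :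
    ∫ X, g (X i) * h X ∂(Measure.pi μ) = (∫ y, g y ∂(μ i)) * ∫ X, h X ∂(Measure.pi μ) := by
  have hind : iIndepFun (fun (k : ι) (X : ι → α) => X k) (Measure.pi μ) :=
    iIndepFun_pi (X := fun _ => id) fun _ => aemeasurable_id
  have h2 := hind.indepFun_finset {i} {i}ᶜ (by simp) fun k => measurable_pi_apply k
  let ext : (({i}ᶜ : Finset ι) → α) → (ι → α) := fun Y k =>
    if hk : k ∈ ({i}ᶜ : Finset ι) then Y ⟨k, hk⟩ else default
  have hext : Measurable ext := by
    refine measurable_pi_lambda _ fun k => ?_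
    by_cases hk : k ∈ ({i}ᶜ : Finset ι)
    · simp only [ext, dif_pos hk]; exact measurable_pi_apply _
    · simp only [ext, dif_neg hk]; exact measurable_const
  have hrest : ∀ X : ι → α, h (ext fun k => X k) = h X := by
    intro X
    rw [← hupd X default]
    congr 1
    funext k
    by_cases hk : k = i
    · subst hk; simp [ext]
    · simp [ext, hk]
  have h3 := (h2.comp (φ := fun Y => g (Y ⟨i, Finset.mem_singleton_self i⟩))
    (ψ := fun Y => h (ext Y)) (by fun_prop) (by fun_prop)).integral_fun_mul_eq_mul_integral
    (Measurable.aestronglyMeasurable (by fun_prop)) (Measurable.aestronglyMeasurable (by fun_prop))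
  simp only [Function.comp_def, hrest] at h3
  rw [h3]
  congr 1
  exact integral_comp_eval (μ := μ) (i := i) (f := g) hg.aestronglyMeasurable

/-- The number of points with index in `D` that fall into `A`. -/
noncomputable def count (D : Finset ι) (A : Set α) (X : ι → α) : ℝ := ∑ l ∈ D, ind A (X l)

lemma count_eq_card (D : Finset ι) (A : Set α) (X : ι → α) :
    ∃ T : Finset ι, count D A X = T.card ∧
      ∀ c : ℝ, ∏ l ∈ D, (1 - c * ind A (X l)) = (1 - c) ^ T.card := by
  classical
  refine ⟨D.filter fun l => X l ∈ A, ?_, fun c => ?_⟩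
  · unfold count ind
    rw [Finset.card_filter]
    push_cast
    exact Finset.sum_congr rfl fun l _ => by simp [Set.indicator_apply]
  · rw [← Finset.prod_const, Finset.prod_filter]
    refine Finset.prod_congr rfl fun l _ => ?_
    by_cases h : X l ∈ A <;> simp [ind_of_mem, ind_of_notMem, h]

lemma measurable_count [MeasurableSpace α] (D : Finset ι) {A : Set α} (hA : MeasurableSet A) :
    Measurable (count (ι := ι) D A) := by
  unfold count
  exact Finset.measurable_sum _ fun l _ => (measurable_ind hA).comp (measurable_pi_apply l)

lemma count_nonneg (D : Finset ι) (A : Set α) (X : ι → α) : 0 ≤ count D A X :=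
  Finset.sum_nonneg fun _ _ => ind_nonneg _ _

lemma inv_count_le_one (D : Finset ι) (A : Set α) (X : ι → α) : (count D A X)⁻¹ ≤ 1 := by
  obtain ⟨T, h, -⟩ := count_eq_card D A X
  rw [h]
  rcases Nat.eq_zero_or_pos T.card with h0 | h0
  · simp [h0]
  · exact inv_le_one_of_one_le₀ (by exact_mod_cast h0)

lemma ind_div_count_eq [DecidableEq ι] (D : Finset ι) (A : Set α) (X : ι → α) {i : ι}
    (hi : i ∈ D) :
    ind A (X i) * (count D A X)⁻¹ = ind A (X i) * (1 + count (D.erase i) A X)⁻¹ := by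
  by_cases h : X i ∈ A
  · unfold count
    rw [← Finset.add_sum_erase D _ hi, ind_of_mem h]
  · simp [ind_of_notMem h]

lemma count_erase_update [DecidableEq ι] (D : Finset ι) (A : Set α) (X : ι → α) (i : ι) (y : α) :
    count (D.erase i) A (Function.update X i y) = count (D.erase i) A X := by
  unfold count
  refine Finset.sum_congr rfl fun l hl => ?_
  rw [Function.update_of_ne (Finset.ne_of_mem_erase hl)]

/-- For `c = 1` the product is the indicator of no point falling into `A`, and for `c = 1 / 2` it is
`2 ^ (-N)` for the number `N` of points in `A`. -/
lemma integral_prod_one_sub_ind_le [Fintype ι] [DecidableEq ι] [MeasurableSpace α]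
    (μ : ι → Measure α) [∀ i, IsProbabilityMeasure (μ i)]
    (D : Finset ι) {A : Set α} (hA : MeasurableSet A) {c q : ℝ} (hc0 : 0 ≤ c) (hc1 : c ≤ 1)
    (hq : ∀ i ∈ D, q ≤ (μ i).real A) :
    ∫ X, ∏ l ∈ D, (1 - c * ind A (X l)) ∂(Measure.pi μ) ≤ Real.exp (-(c * q * D.card)) := by
  have h1 : ∀ X : ι → α, ∏ l ∈ D, (1 - c * ind A (X l))
      = ∏ l, (if l ∈ D then fun y => 1 - c * ind A y else fun _ => 1) (X l) := by
    intro X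
    rw [← Finset.prod_subset (Finset.subset_univ D)]
    · exact Finset.prod_congr rfl fun l hl => by simp [hl]
    · intro l _ hl; simp [hl]
  simp only [h1]
  rw [integral_fintype_prod_eq_prod (μ := μ)
    (f := fun l => if l ∈ D then fun y => 1 - c * ind A y else fun _ => 1)]
  rw [← Finset.prod_subset (Finset.subset_univ D)
    (f := fun l => ∫ y, (if l ∈ D then fun y => 1 - c * ind A y else fun _ => 1) y ∂(μ l))]
  swap
  · intro l _ hl; simp [hl]
  have h2 : ∀ l ∈ D, ∫ y, (if l ∈ D then fun y => 1 - c * ind A y else fun _ => 1) y ∂(μ l)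
      = 1 - c * (μ l).real A := by
    intro l hl
    simp only [if_pos hl]
    rw [integral_sub (integrable_const _), integral_const_mul, integral_ind _ hA]
    · simp
    · refine Integrable.const_mul ?_ _
      exact (integrable_const (1 : ℝ)).indicator hA
  rw [Finset.prod_congr rfl h2]
  calc ∏ l ∈ D, (1 - c * (μ l).real A) ≤ ∏ _l ∈ D, Real.exp (-(c * q)) := by
        refine Finset.prod_le_prod (fun l _ => ?_) fun l hl => ?_
        · have : c * (μ l).real A ≤ 1 := mul_le_one₀ hc1 measureReal_nonneg measureReal_le_one
          linarith
        · have h3 : c * q ≤ c * (μ l).real A := mul_le_mul_of_nonneg_left (hq l hl) hc0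
          linarith [Real.add_one_le_exp (-(c * q))]
    _ = Real.exp (-(c * q * D.card)) := by
        rw [Finset.prod_const, ← Real.exp_nat_mul]; congr 1; ring

/-- The probability that no point falls into `A`. -/
lemma integral_count_eq_zero_le [Fintype ι] [DecidableEq ι] [MeasurableSpace α]
    (μ : ι → Measure α) [∀ i, IsProbabilityMeasure (μ i)]
    (D : Finset ι) {A : Set α} (hA : MeasurableSet A) {q : ℝ}
    (hq : ∀ i ∈ D, q ≤ (μ i).real A) :
    ∫ X, (if count D A X = 0 then 1 else 0) ∂(Measure.pi μ) ≤ Real.exp (-(q * D.card)) := by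
  have h := integral_prod_one_sub_ind_le μ D hA zero_le_one le_rfl hq
  simp only [one_mul] at h
  convert h using 3 with X
  obtain ⟨T, h1, h2⟩ := count_eq_card D A X
  have h3 := h2 1
  simp only [one_mul] at h3
  rw [h1, h3]
  simp [zero_pow_eq]

lemma integrable_of_abs_le {β : Type*} [MeasurableSpace β] {P : Measure β} [IsFiniteMeasure P]
    {f : β → ℝ} (hf : Measurable f) {C : ℝ} (hC : ∀ x, |f x| ≤ C) : Integrable f P :=
  Integrable.of_bound hf.aestronglyMeasurable C (ae_of_all _ hC)

lemma integrable_inv_count [Fintype ι] [MeasurableSpace α]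
    (μ : ι → Measure α) [∀ i, IsProbabilityMeasure (μ i)]
    (D : Finset ι) {A : Set α} (hA : MeasurableSet A) :
    Integrable (fun X => (count D A X)⁻¹) (Measure.pi μ) :=
  integrable_of_abs_le (measurable_count D hA).inv fun X => by
    rw [abs_of_nonneg (inv_nonneg.2 (count_nonneg D A X))]
    exact inv_count_le_one D A X

/-- If many points are expected in `A`, then the mean of the inverse of their number `N` is small:
either `N ≥ 72`, or `2 ^ 72 / 2 ^ N ≥ 1`. The inverse counts as `0` for `N = 0`. -/
lemma integral_inv_count_le [Fintype ι] [DecidableEq ι] [MeasurableSpace α]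
    (μ : ι → Measure α) [∀ i, IsProbabilityMeasure (μ i)]
    (D : Finset ι) {A : Set α} (hA : MeasurableSet A) {q : ℝ}
    (hq : ∀ i ∈ D, q ≤ (μ i).real A) :
    ∫ X, (count D A X)⁻¹ ∂(Measure.pi μ)
      ≤ 1 / 72 + 2 ^ 72 * Real.exp (-(1 / 2 * q * D.card)) := by
  have h := integral_prod_one_sub_ind_le μ D hA (c := 1 / 2) (by norm_num) (by norm_num) hq
  have hm : Measurable fun X : ι → α => ∏ l ∈ D, (1 - 1 / 2 * ind A (X l)) := by
    refine Finset.measurable_prod _ fun l _ => ?_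
    exact (((measurable_ind hA).comp (measurable_pi_apply l)).const_mul _).const_sub _
  have hi : Integrable (fun X : ι → α => ∏ l ∈ D, (1 - 1 / 2 * ind A (X l))) (Measure.pi μ) := by
    refine integrable_of_abs_le (C := 1) hm fun X => ?_
    obtain ⟨T, -, h2⟩ := count_eq_card D A X
    rw [h2, abs_of_nonneg (by positivity)]
    exact pow_le_one₀ (by norm_num) (by norm_num)
  calc ∫ X, (count D A X)⁻¹ ∂(Measure.pi μ)
      ≤ ∫ X, (1 / 72 + 2 ^ 72 * ∏ l ∈ D, (1 - 1 / 2 * ind A (X l))) ∂(Measure.pi μ) := by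
        refine integral_mono (integrable_inv_count μ D hA)
          ((integrable_const _).add (hi.const_mul _)) fun X => ?_
        obtain ⟨T, h1, h2⟩ := count_eq_card D A X
        simp only [h1, h2]
        have hpos : (0 : ℝ) < (1 - 1 / 2) ^ T.card := by positivity
        rcases le_total 72 T.card with h3 | h3
        · have : ((T.card : ℝ))⁻¹ ≤ 1 / 72 := by
            rw [one_div]
            exact inv_anti₀ (by norm_num) (by exact_mod_cast h3)
          have : (0 : ℝ) ≤ 2 ^ 72 * (1 - 1 / 2) ^ T.card := by positivity
          linarith
        · have h4 : ((T.card : ℝ))⁻¹ ≤ 1 := by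
            have := inv_count_le_one D A X
            rwa [h1] at this
          have h5 : (1 : ℝ) ≤ 2 ^ 72 * (1 - 1 / 2) ^ T.card := by
            calc (1 : ℝ) = 2 ^ 72 * (1 - 1 / 2) ^ 72 := by norm_num
              _ ≤ 2 ^ 72 * (1 - 1 / 2) ^ T.card :=
                mul_le_mul_of_nonneg_left
                  (pow_le_pow_of_le_one (by norm_num) (by norm_num) h3) (by positivity)
          linarith
    _ = 1 / 72 + 2 ^ 72 * ∫ X, ∏ l ∈ D, (1 - 1 / 2 * ind A (X l)) ∂(Measure.pi μ) := by
        rw [integral_add (integrable_const _) (hi.const_mul _), integral_const_mul]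
        simp
    _ ≤ _ := by gcongr

/-- Mean squared error of the average of `v + a` over the points in `A`, when `v` is centred on
`A`. By independence the products of the values of `v` at two distinct points have mean zero, so
that only the diagonal contributes to the variance. -/
lemma integral_sq_average_le [Fintype ι] [DecidableEq ι] [MeasurableSpace α] [Inhabited α]
    (μ : ι → Measure α) [∀ i, IsProbabilityMeasure (μ i)]
    (D : Finset ι) {A : Set α} (hA : MeasurableSet A) {v : α → ℝ} (hv : Measurable v) {s : ℝ}
    (hs : ∀ y ∈ A, |v y| ≤ s) (hmean : ∀ i ∈ D, ∫ y, ind A y * v y ∂(μ i) = 0) (a : ℝ) :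
    ∫ X, (∑ i ∈ D, ind A (X i) / count D A X * (v (X i) + a)) ^ 2 ∂(Measure.pi μ)
      ≤ a ^ 2 + s ^ 2 * ∫ X, (count D A X)⁻¹ ∂(Measure.pi μ) := by
  set g : α → ℝ := fun y => ind A y * v y with hg_def
  have hg : Measurable g := (measurable_ind hA).mul hv
  have hgs : ∀ y, |g y| ≤ |s| := by
    intro y
    by_cases h : y ∈ A
    · simp only [hg_def, ind_of_mem h, one_mul]; exact (hs y h).trans (le_abs_self s)
    · simp [hg_def, ind_of_notMem h]
  have hgi : ∀ y, g y = g y * ind A y := by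
    intro y
    by_cases h : y ∈ A <;> simp [hg_def, ind_of_mem, ind_of_notMem, h]
  have hN := measurable_count (ι := ι) D hA
  have hN0 : ∀ X, 0 ≤ (count D A X)⁻¹ := fun X => inv_nonneg.2 (count_nonneg D A X)
  have hgX : ∀ i, Measurable fun X : ι → α => g (X i) := fun i => hg.comp (measurable_pi_apply i)
  -- the two kinds of terms with mean zero
  have z1 : ∀ i ∈ D, ∫ X, g (X i) * (count D A X)⁻¹ ∂(Measure.pi μ) = 0 := by
    intro i hi
    have e : ∀ X : ι → α, g (X i) * (count D A X)⁻¹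
        = g (X i) * (1 + count (D.erase i) A X)⁻¹ := by
      intro X
      rw [hgi, mul_assoc, ind_div_count_eq D A X hi, ← mul_assoc]
    simp only [e]
    rw [integral_pi_mul_of_update μ i hg
      (h := fun X => (1 + count (D.erase i) A X)⁻¹)
      ((measurable_count (D.erase i) hA).const_add 1).inv
      (fun X y => by rw [count_erase_update]), hmean i hi, zero_mul]
  have z2 : ∀ i ∈ D, ∀ l ∈ D.erase i,
      ∫ X, g (X i) * g (X l) * ((count D A X)⁻¹) ^ 2 ∂(Measure.pi μ) = 0 := by
    intro i hi l hl
    have e : ∀ X : ι → α, g (X i) * g (X l) * ((count D A X)⁻¹) ^ 2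
        = g (X i) * (g (X l) * ((1 + count (D.erase i) A X)⁻¹) ^ 2) := by
      intro X
      by_cases h : X i ∈ A
      · have h' := ind_div_count_eq D A X hi
        rw [ind_of_mem h, one_mul, one_mul] at h'
        rw [h', mul_assoc]
      · simp [hg_def, ind_of_notMem h]
    simp only [e]
    rw [integral_pi_mul_of_update μ i hg
      (h := fun X => g (X l) * ((1 + count (D.erase i) A X)⁻¹) ^ 2)
      ((hgX l).mul (((measurable_count (D.erase i) hA).const_add 1).inv.pow_const 2))
      (fun X y => by
        rw [count_erase_update, Function.update_of_ne (Finset.ne_of_mem_erase hl)]),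
      hmean i hi, zero_mul]
  have i1 : ∀ i, Integrable (fun X => g (X i) * (count D A X)⁻¹) (Measure.pi μ) := by
    intro i
    refine integrable_of_abs_le (C := |s| * 1) ((hgX i).mul hN.inv) fun X => ?_
    rw [abs_mul, abs_of_nonneg (hN0 X)]
    exact mul_le_mul (hgs _) (inv_count_le_one D A X) (hN0 X) (abs_nonneg s)
  have i2 : ∀ i l, Integrable (fun X => g (X i) * g (X l) * ((count D A X)⁻¹) ^ 2)
      (Measure.pi μ) := by
    intro i l
    refine integrable_of_abs_le (C := |s| * |s| * 1)
      (((hgX i).mul (hgX l)).mul (hN.inv.pow_const 2)) fun X => ?_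
    rw [abs_mul, abs_mul, abs_of_nonneg (pow_nonneg (hN0 X) 2)]
    exact mul_le_mul (mul_le_mul (hgs _) (hgs _) (abs_nonneg _) (abs_nonneg s))
      (pow_le_one₀ (hN0 X) (inv_count_le_one D A X)) (pow_nonneg (hN0 X) 2) (by positivity)
  have i3 := integrable_inv_count μ D hA
  have iB : Integrable (fun X => (∑ i ∈ D, ∑ l ∈ D.erase i,
      g (X i) * g (X l) * ((count D A X)⁻¹) ^ 2)
      + 2 * a * (∑ i ∈ D, g (X i) * (count D A X)⁻¹)) (Measure.pi μ) :=
    (integrable_finsetSum _ fun i _ => integrable_finsetSum _ fun l _ => i2 i l).add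
      ((integrable_finsetSum _ fun i _ => i1 i).const_mul _)
  -- the diagonal and the constant part are bounded for every sample
  have hpt : ∀ X : ι → α, (∑ i ∈ D, ind A (X i) / count D A X * (v (X i) + a)) ^ 2
      ≤ ((∑ i ∈ D, ∑ l ∈ D.erase i, g (X i) * g (X l) * ((count D A X)⁻¹) ^ 2)
        + 2 * a * (∑ i ∈ D, g (X i) * (count D A X)⁻¹)) + (a ^ 2 + s ^ 2 * (count D A X)⁻¹) := by
    intro X
    have e1 : ∑ i ∈ D, ind A (X i) / count D A X * (v (X i) + a)
        = (∑ i ∈ D, g (X i)) * (count D A X)⁻¹ + a * (count D A X * (count D A X)⁻¹) := by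
      rw [Finset.sum_mul]
      conv_rhs => rw [count, Finset.sum_mul, Finset.mul_sum, ← count, ← Finset.sum_add_distrib]
      exact Finset.sum_congr rfl fun i _ => by simp only [hg_def, div_eq_mul_inv]; ring
    have e2 : (∑ i ∈ D, g (X i)) ^ 2
        = (∑ i ∈ D, ∑ l ∈ D.erase i, g (X i) * g (X l)) + ∑ i ∈ D, g (X i) ^ 2 := by
      rw [sq, Finset.sum_mul_sum, ← Finset.sum_add_distrib]
      refine Finset.sum_congr rfl fun i hi => ?_
      rw [← Finset.sum_erase_add D _ hi, sq]
    have e3 : ∑ i ∈ D, g (X i) ^ 2 ≤ s ^ 2 * count D A X := by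
      rw [count, Finset.mul_sum]
      refine Finset.sum_le_sum fun i _ => ?_
      by_cases h : X i ∈ A
      · simp only [hg_def, ind_of_mem h, one_mul, mul_one]
        exact sq_le_sq' (by linarith [neg_abs_le (v (X i)), hs _ h])
          ((le_abs_self _).trans (hs _ h))
      · simp [hg_def, ind_of_notMem h]
    have e4 : (∑ i ∈ D, ∑ l ∈ D.erase i, g (X i) * g (X l) * ((count D A X)⁻¹) ^ 2)
        = (∑ i ∈ D, ∑ l ∈ D.erase i, g (X i) * g (X l)) * ((count D A X)⁻¹) ^ 2 := by
      simp only [Finset.sum_mul]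
    rw [e1, e4, ← Finset.sum_mul]
    by_cases h0 : count D A X = 0
    · rw [h0]; simp; positivity
    · rw [mul_inv_cancel₀ h0]
      have e5 : s ^ 2 * count D A X * ((count D A X)⁻¹) ^ 2 = s ^ 2 * (count D A X)⁻¹ := by
        field_simp
      have e6 := mul_le_mul_of_nonneg_right e3 (sq_nonneg ((count D A X)⁻¹))
      rw [e5] at e6
      have e7 : ((∑ i ∈ D, g (X i)) * (count D A X)⁻¹ + a * 1) ^ 2
          = (∑ i ∈ D, g (X i)) ^ 2 * ((count D A X)⁻¹) ^ 2
            + 2 * a * ((∑ i ∈ D, g (X i)) * (count D A X)⁻¹) + a ^ 2 := by ring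
      rw [e7, e2, add_mul]
      linarith
  have iC : Integrable (fun X => a ^ 2 + s ^ 2 * (count D A X)⁻¹) (Measure.pi μ) :=
    (integrable_const _).add (i3.const_mul _)
  refine (integral_mono_of_nonneg (ae_of_all _ fun X => sq_nonneg _) (iB.add iC)
    (ae_of_all _ hpt)).trans_eq ?_
  simp only [Pi.add_apply]
  rw [integral_add iB iC, integral_add
    (integrable_finsetSum _ fun i _ => integrable_finsetSum _ fun l _ => i2 i l)
    ((integrable_finsetSum _ fun i _ => i1 i).const_mul _), integral_const_mul,
    integral_finsetSum _ fun i _ => i1 i,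
    integral_finsetSum _ fun i _ => integrable_finsetSum _ fun l _ => i2 i l,
    Finset.sum_eq_zero z1, integral_add (integrable_const _) (i3.const_mul _),
    integral_const_mul]
  rw [Finset.sum_eq_zero fun i hi => by
    rw [integral_finsetSum _ fun l _ => i2 i l, Finset.sum_eq_zero (z2 i hi)]]
  simp

lemma integrable_sq_average [Fintype ι] [DecidableEq ι] [MeasurableSpace α]
    (μ : ι → Measure α) [∀ i, IsProbabilityMeasure (μ i)]
    (D : Finset ι) {A : Set α} (hA : MeasurableSet A) {v : α → ℝ} (hv : Measurable v) {s : ℝ}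
    (hs : ∀ y ∈ A, |v y| ≤ s) (a : ℝ) :
    Integrable (fun X => (∑ i ∈ D, ind A (X i) / count D A X * (v (X i) + a)) ^ 2)
      (Measure.pi μ) := by
  have hN := measurable_count (ι := ι) D hA
  refine integrable_of_abs_le (C := (∑ _i ∈ D, (|s| + |a|)) ^ 2) ?_ fun X => ?_
  · refine (Finset.measurable_sum _ fun i _ => ?_).pow_const 2
    have h1 := (measurable_ind hA).comp (measurable_pi_apply (X := fun _ : ι => α) i)
    have h2 := hv.comp (measurable_pi_apply (X := fun _ : ι => α) i)
    exact (h1.div hN).mul (h2.add_const a)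
  · rw [abs_pow]
    refine pow_le_pow_left₀ (abs_nonneg _) ((Finset.abs_sum_le_sum_abs _ _).trans
      (Finset.sum_le_sum fun i _ => ?_)) 2
    by_cases h : X i ∈ A
    · rw [ind_of_mem h, one_div, abs_mul, abs_of_nonneg (inv_nonneg.2 (count_nonneg D A X))]
      have h1 : |v (X i) + a| ≤ |s| + |a| :=
        (abs_add_le _ _).trans (add_le_add ((hs _ h).trans (le_abs_self s)) le_rfl)
      calc (count D A X)⁻¹ * |v (X i) + a| ≤ 1 * (|s| + |a|) :=
            mul_le_mul (inv_count_le_one D A X) h1 (abs_nonneg _) zero_le_one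
        _ = _ := one_mul _
    · rw [ind_of_notMem h]
      simp only [zero_div, zero_mul, abs_zero]
      positivity

end Independent

/-! ### Leaves of centered trees -/

/-- How often coordinate `j` is cut on the path `θ`. -/
def cuts {p M : ℕ} (θ : Fin M → Fin p) (j : Fin p) : ℕ := ∑ t, if θ t = j then 1 else 0

/-- The box all of whose sides are `[a, b)`. -/
def constBox (p : ℕ) (a b : ℝ) : Box p := ⟨fun _ => a, fun _ => b⟩

lemma child_side {p : ℕ} (B : Box p) (x : Fin p → ℝ) (i j : Fin p) :
    ((B.child x i).lo j, (B.child x i).hi j) =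
      if i = j then cut (x j) (B.lo j, B.hi j) else (B.lo j, B.hi j) := by
  unfold Box.child cut
  by_cases hij : i = j
  · subst hij
    rw [if_pos rfl]
    split_ifs <;> simp
  · rw [if_neg hij]
    split_ifs <;> simp [Function.update_of_ne (Ne.symm hij)]

/-- The sides of a leaf decouple: side `j` is the cell around `x j` after as many cuts as
coordinate `j` has received. -/
lemma leaf_side {p M : ℕ} (B : Box p) (θ : Fin M → Fin p) (x : Fin p → ℝ) (j : Fin p) :
    ((leaf B θ x).lo j, (leaf B θ x).hi j) = cell (B.lo j) (B.hi j) (cuts θ j) (x j) := by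
  induction M generalizing B with
  | zero => simp [leaf, cuts, cell_zero]
  | succ M ih =>
    have h1 : leaf B θ x = leaf (B.child x (θ 0)) (fun i => θ i.succ) x := by
      simp [leaf, List.ofFn_succ]
    have h2 : cuts θ j = (if θ 0 = j then 1 else 0) + cuts (fun i => θ i.succ) j := by
      rw [cuts, Fin.sum_univ_succ]; rfl
    have h3 := child_side B x (θ 0) j
    rw [h1, ih, h2]
    by_cases h : θ 0 = j
    · rw [if_pos h] at h3 ⊢
      rw [add_comm 1, cell, cell, Function.iterate_succ_apply, ← h3]
    · rw [if_neg h] at h3 ⊢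
      rw [zero_add, cell, cell, h3]

lemma sum_cuts {p M : ℕ} (θ : Fin M → Fin p) : ∑ j, cuts θ j = M := by
  unfold cuts
  rw [Finset.sum_comm]
  simp

lemma toSet_eq_pi {p : ℕ} (B : Box p) :
    B.toSet = Set.univ.pi fun j => Set.Ico (B.lo j) (B.hi j) := by
  ext y
  simp [Box.toSet]

lemma measurableSet_toSet {p : ℕ} (B : Box p) : MeasurableSet B.toSet := by
  rw [toSet_eq_pi]
  exact MeasurableSet.univ_pi fun _ => measurableSet_Ico

lemma unifCube_real_toSet {p : ℕ} (t : Fin 2) (B : Box p) :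
    (unifCube p t).real B.toSet = ∏ j, (unifSide t).real (Set.Ico (B.lo j) (B.hi j)) := by
  rw [toSet_eq_pi, unifCube_eq, measureReal_def, Measure.pi_pi, ENNReal.toReal_prod]
  rfl

/-- Within a box, each coordinate is centred at the centre of the side of the box, cut down to the
range of the cluster. -/
lemma integral_ind_sub_centre {p : ℕ} (t : Fin 2) (B : Box p) (j : Fin p) :
    ∫ y, ind B.toSet y * (y j - centre (corner t) (corner t + 1 / 2) (B.lo j, B.hi j))
      ∂(unifCube p t) = 0 := by
  set e := centre (corner t) (corner t + 1 / 2) (B.lo j, B.hi j) with he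
  have h : ∀ y : Fin p → ℝ, ind B.toSet y * (y j - e)
      = ∏ k, (fun u => (Set.Ico (B.lo k) (B.hi k)).indicator
        (fun u => if k = j then u - e else 1) u) (y k) := by
    intro y
    by_cases hy : y ∈ B.toSet
    · rw [ind_of_mem hy, one_mul]
      have : ∀ k, (Set.Ico (B.lo k) (B.hi k)).indicator
        (fun u => if k = j then u - e else 1) (y k) = if k = j then y k - e else 1 :=
        fun k => Set.indicator_of_mem (show y k ∈ Set.Ico (B.lo k) (B.hi k) from hy k) _
      simp only [this]
      simp
    · rw [ind_of_notMem hy, zero_mul]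
      have : ∃ k, y k ∉ Set.Ico (B.lo k) (B.hi k) := by
        simpa [Box.toSet] using hy
      obtain ⟨k, hk⟩ := this
      exact (Finset.prod_eq_zero (Finset.mem_univ k) (Set.indicator_of_notMem hk _)).symm
  simp only [h]
  rw [unifCube_eq, integral_fintype_prod_eq_prod]
  refine Finset.prod_eq_zero (Finset.mem_univ j) ?_
  simp only [if_true]
  exact integral_indicator_sub_centre t _ _

/-- The cube of cluster `t` without its upper faces. -/
def halfOpenCube (p : ℕ) (t : Fin 2) : Set (Fin p → ℝ) :=
  {x | ∀ j, x j ∈ Set.Ico (corner t) (corner t + 1 / 2)}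

lemma ae_mem_halfOpenCube (p : ℕ) (t : Fin 2) : ∀ᵐ x ∂(unifCube p t), x ∈ halfOpenCube p t := by
  rw [unifCube_eq]
  exact ae_all_iff.2 fun j =>
    (Measure.quasiMeasurePreserving_eval (fun _ : Fin p => unifSide t) j).ae (ae_unifSide_mem t)

lemma ae_data_mem_halfOpenCube (p m : ℕ) :
    ∀ᵐ X ∂(dataLaw p m), ∀ i, X i ∈ halfOpenCube p i.1 :=
  ae_all_iff.2 fun i =>
    (Measure.quasiMeasurePreserving_eval (fun i : Idx m => unifCube p i.1) i).ae
      (ae_mem_halfOpenCube p i.1)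

/-- The trees for test points of cluster `t` may be grown from the cube `[a, b)^p`: it contains the
cube of the cluster, and each side of a leaf of such a test point has at least the mass for the
cluster which it would have under the uniform law of `[a, b)`. -/
structure Admissible (t : Fin 2) (a b : ℝ) : Prop where
  left : a ≤ corner t
  right : corner t + 1 / 2 ≤ b
  mass : ∀ (K : ℕ) (u : ℝ), u ∈ Set.Ico (corner t) (corner t + 1 / 2) →
    (1 / 2 : ℝ) ^ K ≤ (unifSide t).real (Set.Ico (cell a b K u).1 (cell a b K u).2)

lemma admissible_own (t : Fin 2) : Admissible t (corner t) (corner t + 1 / 2) :=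
  ⟨le_rfl, le_rfl, fun K _ hu => unifSide_cell_own t K hu⟩

lemma admissible_range (t : Fin 2) : Admissible t 0 (3 / 2) := by
  refine ⟨?_, ?_, fun K _ hu => unifSide_cell_range t K hu⟩ <;>
    fin_cases t <;> norm_num [corner]

lemma leaf_mass {p M : ℕ} {t : Fin 2} {a b : ℝ} (hab : Admissible t a b) (θ : Fin M → Fin p)
    {x : Fin p → ℝ} (hx : x ∈ halfOpenCube p t) :
    (1 / 2 : ℝ) ^ M ≤ (unifCube p t).real (leaf (constBox p a b) θ x).toSet := by
  rw [unifCube_real_toSet]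
  calc (1 / 2 : ℝ) ^ M = ∏ j, (1 / 2 : ℝ) ^ cuts θ j := by
        rw [Finset.prod_pow_eq_pow_sum, sum_cuts]
    _ ≤ _ := by
        refine Finset.prod_le_prod (fun j _ => by positivity) fun j _ => ?_
        have h := leaf_side (constBox p a b) θ x j
        have h1 : (leaf (constBox p a b) θ x).lo j = (cell a b (cuts θ j) (x j)).1 :=
          congrArg Prod.fst h
        have h2 : (leaf (constBox p a b) θ x).hi j = (cell a b (cuts θ j) (x j)).2 :=
          congrArg Prod.snd h
        rw [h1, h2]
        exact hab.mass _ _ (hx j)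

/-! ### Expectations over the randomization of the trees -/

section TreeExp

variable {p M : ℕ} {prob : Fin p → ℝ}

lemma treeExp_mono (hprob : ∀ j, 0 ≤ prob j) {F G : (Fin M → Fin p) → ℝ} (h : ∀ θ, F θ ≤ G θ) :
    treeExp M prob F ≤ treeExp M prob G :=
  Finset.sum_le_sum fun θ _ =>
    mul_le_mul_of_nonneg_left (h θ) (Finset.prod_nonneg fun t _ => hprob (θ t))

lemma sum_prod_prob (hsum : ∑ j, prob j = 1) : ∑ θ : Fin M → Fin p, ∏ t, prob (θ t) = 1 := by
  rw [← Fintype.sum_pow, hsum, one_pow]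

lemma treeExp_const (hsum : ∑ j, prob j = 1) (c : ℝ) :
    treeExp M prob (fun _ => c) = c := by
  unfold treeExp
  rw [← Finset.sum_mul, sum_prod_prob hsum, one_mul]

lemma treeExp_add (F G : (Fin M → Fin p) → ℝ) :
    treeExp M prob (fun θ => F θ + G θ) = treeExp M prob F + treeExp M prob G := by
  simp only [treeExp, mul_add, Finset.sum_add_distrib]

lemma treeExp_mul_left (c : ℝ) (F : (Fin M → Fin p) → ℝ) :
    treeExp M prob (fun θ => c * F θ) = c * treeExp M prob F := by
  simp only [treeExp, Finset.mul_sum]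
  exact Finset.sum_congr rfl fun _ _ => by ring

lemma sum_treeExp_mul {ι : Type*} (s : Finset ι) (F : ι → (Fin M → Fin p) → ℝ) (y : ι → ℝ) :
    ∑ i ∈ s, treeExp M prob (F i) * y i = treeExp M prob (fun θ => ∑ i ∈ s, F i θ * y i) := by
  simp only [treeExp, Finset.sum_mul, Finset.mul_sum]
  rw [Finset.sum_comm]
  exact Finset.sum_congr rfl fun _ _ => Finset.sum_congr rfl fun _ _ => by ring

lemma sq_treeExp_le (hprob : ∀ j, 0 ≤ prob j) (hsum : ∑ j, prob j = 1)
    (F : (Fin M → Fin p) → ℝ) :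
    (treeExp M prob F) ^ 2 ≤ treeExp M prob (fun θ => F θ ^ 2) :=
  Real.pow_arith_mean_le_arith_mean_pow_of_even Finset.univ _ _
    (fun θ _ => Finset.prod_nonneg fun t _ => hprob (θ t)) (sum_prod_prob hsum) even_two

lemma integrable_treeExp {β : Type*} [MeasurableSpace β] {P : Measure β}
    {F : (Fin M → Fin p) → β → ℝ} (hF : ∀ θ, Integrable (F θ) P) :
    Integrable (fun X => treeExp M prob (fun θ => F θ X)) P :=
  integrable_finsetSum _ fun θ _ => (hF θ).const_mul _

lemma integral_treeExp {β : Type*} [MeasurableSpace β] {P : Measure β}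
    {F : (Fin M → Fin p) → β → ℝ} (hF : ∀ θ, Integrable (F θ) P) :
    ∫ X, treeExp M prob (fun θ => F θ X) ∂P = treeExp M prob (fun θ => ∫ X, F θ X ∂P) := by
  unfold treeExp
  rw [integral_finsetSum _ fun θ _ => (hF θ).const_mul _]
  exact Finset.sum_congr rfl fun θ _ => integral_const_mul _ _

/-- The number of cuts along `j` is binomial. -/
lemma treeExp_pow_cuts (hsum : ∑ j, prob j = 1) (c : ℝ) (j : Fin p) :
    treeExp M prob (fun θ => c ^ cuts θ j) = (1 - (1 - c) * prob j) ^ M := by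
  have h1 : ∑ i, prob i * (if i = j then c else 1) = 1 - (1 - c) * prob j := by
    have : ∀ i, prob i * (if i = j then c else 1)
        = prob i - (if i = j then (1 - c) * prob i else 0) := by
      intro i; split_ifs <;> ring
    simp only [this, Finset.sum_sub_distrib, hsum]
    simp
  rw [← h1, Fintype.sum_pow]
  unfold treeExp
  refine Finset.sum_congr rfl fun θ _ => ?_
  simp only [Finset.prod_mul_distrib, cuts]
  rw [← Finset.prod_pow_eq_pow_sum]
  congr 1
  refine Finset.prod_congr rfl fun t _ => ?_
  split_ifs <;> simp

end TreeExp

/-! ### Bias of a forest at a fixed test point -/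

/-- The prediction error, in coordinate `j`, of the tree `θ` trained on the points of cluster `t`:
the mean of `X i j - x j` over the points in the leaf of `x`. -/
noncomputable def treeError {p m M : ℕ} (t : Fin 2) (a b : ℝ) (θ : Fin M → Fin p) (j : Fin p)
    (x : Fin p → ℝ) (X : Idx m → Fin p → ℝ) : ℝ :=
  ∑ i ∈ cluster m t, ind (leaf (constBox p a b) θ x).toSet (X i)
    / count (cluster m t) (leaf (constBox p a b) θ x).toSet X * (X i j - x j)

/-- Indicator of the event that the leaf of `x` contains no point of cluster `t`. -/
noncomputable def emptyLeaf {p m M : ℕ} (t : Fin 2) (a b : ℝ) (θ : Fin M → Fin p)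
    (x : Fin p → ℝ) (X : Idx m → Fin p → ℝ) : ℝ :=
  if count (cluster m t) (leaf (constBox p a b) θ x).toSet X = 0 then 1 else 0

lemma card_cluster (m : ℕ) (t : Fin 2) : (cluster m t).card = m := by
  have : cluster m t = {t} ×ˢ Finset.univ := by
    ext ⟨s, i⟩; simp [cluster, eq_comm]
  rw [this, Finset.card_product]; simp

section FixedPoint

variable {p m M : ℕ} {t : Fin 2} {a b : ℝ} {x : Fin p → ℝ}

lemma abs_sub_centre_le_of_mem_leaf (hab : Admissible t a b) (θ : Fin M → Fin p) (j : Fin p)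
    (hx : x ∈ halfOpenCube p t) {y : Fin p → ℝ} (hy : y ∈ (leaf (constBox p a b) θ x).toSet) :
    |y j - centre (corner t) (corner t + 1 / 2) (cell a b (cuts θ j) (x j))|
      ≤ (b - a) / 2 ^ cuts θ j := by
  have h := leaf_side (constBox p a b) θ x j
  have h1 : (leaf (constBox p a b) θ x).lo j = (cell a b (cuts θ j) (x j)).1 := congrArg Prod.fst h
  have h2 : (leaf (constBox p a b) θ x).hi j = (cell a b (cuts θ j) (x j)).2 := congrArg Prod.snd h
  have hy' := hy j
  rw [h1, h2] at hy'
  have hx' := cell_mem (a := a) (b := b) (cuts θ j) (hab.left.trans (hx j).1)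
    ((hx j).2.trans_le hab.right)
  rw [← cell_length a b (cuts θ j) (x j)]
  have h3 := abs_centre_sub_le hx'.1 hx'.2.le (hx j).1 (hx j).2.le
  generalize cell a b (cuts θ j) (x j) = I at *
  have h4 : I.1 ≤ centre (corner t) (corner t + 1 / 2) I := by
    have := le_max_left I.1 (corner t)
    have : I.1 ≤ min I.2 (corner t + 1 / 2) :=
      le_min (by linarith) (by linarith [(hx j).2])
    unfold centre; linarith
  have h5 : centre (corner t) (corner t + 1 / 2) I ≤ I.2 := by
    have := min_le_left I.2 (corner t + 1 / 2)
    have : max I.1 (corner t) ≤ I.2 := max_le (by linarith) (by linarith [(hx j).1])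
    unfold centre; linarith
  rw [abs_le]
  constructor <;> linarith [hy'.1, hy'.2]

lemma treeError_eq (θ : Fin M → Fin p) (j : Fin p) (e : ℝ) (X : Idx m → Fin p → ℝ) :
    treeError t a b θ j x X = ∑ i ∈ cluster m t, ind (leaf (constBox p a b) θ x).toSet (X i)
      / count (cluster m t) (leaf (constBox p a b) θ x).toSet X * ((X i j - e) + (e - x j)) := by
  unfold treeError
  exact Finset.sum_congr rfl fun i _ => by ring

lemma integrable_sq_treeError (hab : Admissible t a b) (θ : Fin M → Fin p) (j : Fin p)
    (hx : x ∈ halfOpenCube p t) :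
    Integrable (fun X => treeError t a b θ j x X ^ 2) (dataLaw p m) := by
  simp only [treeError_eq θ j (centre (corner t) (corner t + 1 / 2) (cell a b (cuts θ j) (x j)))]
  exact integrable_sq_average (fun i : Idx m => unifCube p i.1) (cluster m t)
    (measurableSet_toSet _) (v := fun y => y j - _) ((measurable_pi_apply j).sub_const _)
    (fun y hy => abs_sub_centre_le_of_mem_leaf hab θ j hx hy) _

/-- Bias and variance of one tree, when so many points are expected in a leaf that the mean of the
inverse of their number is at most `1 / 36`. -/
lemma integral_sq_treeError_le (hab : Admissible t a b) (θ : Fin M → Fin p) (j : Fin p)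
    (hx : x ∈ halfOpenCube p t)
    (hlarge : 2 ^ 72 * Real.exp (-(1 / 2 * (1 / 2 : ℝ) ^ M * m)) ≤ 1 / 72) :
    ∫ X, treeError t a b θ j x X ^ 2 ∂(dataLaw p m)
      ≤ (centre (corner t) (corner t + 1 / 2) (cell a b (cuts θ j) (x j)) - x j) ^ 2
        + ((b - a) / 2 ^ cuts θ j) ^ 2 / 36 := by
  set e := centre (corner t) (corner t + 1 / 2) (cell a b (cuts θ j) (x j)) with he
  have hmass : ∀ i ∈ cluster m t, (1 / 2 : ℝ) ^ M
      ≤ (unifCube p i.1).real (leaf (constBox p a b) θ x).toSet := by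
    intro i hi
    rw [(Finset.mem_filter.1 hi).2]
    exact leaf_mass hab θ hx
  have hmean : ∀ i ∈ cluster m t,
      ∫ y, ind (leaf (constBox p a b) θ x).toSet y * (y j - e) ∂(unifCube p i.1) = 0 := by
    intro i hi
    rw [(Finset.mem_filter.1 hi).2, he]
    have h := leaf_side (constBox p a b) θ x j
    have h' := integral_ind_sub_centre t (leaf (constBox p a b) θ x) j
    rw [h] at h'
    exact h'
  simp only [treeError_eq θ j e]
  have h1 := integral_sq_average_le (fun i : Idx m => unifCube p i.1) (cluster m t)
    (measurableSet_toSet (leaf (constBox p a b) θ x)) (v := fun y => y j - e)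
    ((measurable_pi_apply j).sub_const _)
    (fun y hy => abs_sub_centre_le_of_mem_leaf hab θ j hx hy) hmean (e - x j)
  have h2 := integral_inv_count_le (fun i : Idx m => unifCube p i.1) (cluster m t)
    (measurableSet_toSet (leaf (constBox p a b) θ x)) hmass
  rw [card_cluster] at h2
  have h3 : ∫ X, (count (cluster m t) (leaf (constBox p a b) θ x).toSet X)⁻¹ ∂(dataLaw p m)
      ≤ 1 / 36 := by
    have : (1 / 36 : ℝ) = 1 / 72 + 1 / 72 := by norm_num
    rw [this]
    exact h2.trans (by linarith)
  refine h1.trans ?_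
  have h4 := mul_le_mul_of_nonneg_left h3 (sq_nonneg ((b - a) / 2 ^ cuts θ j))
  have h5 : ((b - a) / 2 ^ cuts θ j) ^ 2 / 36 = ((b - a) / 2 ^ cuts θ j) ^ 2 * (1 / 36) := by ring
  rw [h5]
  exact add_le_add_right h4 _

lemma integrable_emptyLeaf (θ : Fin M → Fin p) :
    Integrable (fun X => emptyLeaf t a b θ x X) (dataLaw p m) := by
  refine integrable_of_abs_le (C := 1) ?_ fun X => ?_
  · unfold emptyLeaf
    exact Measurable.ite
      (measurable_count (cluster m t) (measurableSet_toSet _) (measurableSet_singleton 0))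
      measurable_const measurable_const
  · unfold emptyLeaf
    split_ifs <;> simp

lemma integral_emptyLeaf_le (hab : Admissible t a b) (θ : Fin M → Fin p)
    (hx : x ∈ halfOpenCube p t) :
    ∫ X, emptyLeaf t a b θ x X ∂(dataLaw p m) ≤ Real.exp (-((1 / 2 : ℝ) ^ M * m)) := by
  have h := integral_count_eq_zero_le (fun i : Idx m => unifCube p i.1) (cluster m t)
    (measurableSet_toSet (leaf (constBox p a b) θ x)) (q := (1 / 2 : ℝ) ^ M) (by
      intro i hi
      rw [(Finset.mem_filter.1 hi).2]
      exact leaf_mass hab θ hx)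
  rw [card_cluster] at h
  exact h

lemma emptyLeaf_nonneg (θ : Fin M → Fin p) (X : Idx m → Fin p → ℝ) :
    0 ≤ emptyLeaf t a b θ x X := by
  unfold emptyLeaf
  split_ifs <;> simp

lemma forestWeight_sum (prob : Fin p → ℝ) (X : Idx m → Fin p → ℝ) (y : Idx m → ℝ) :
    ∑ i, forestWeight M prob (constBox p a b) (cluster m t) X x i * y i
      = treeExp M prob fun θ => ∑ i ∈ cluster m t,
        ind (leaf (constBox p a b) θ x).toSet (X i)
          / count (cluster m t) (leaf (constBox p a b) θ x).toSet X * y i := by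
  unfold forestWeight
  rw [sum_treeExp_mul]
  congr 1
  funext θ
  rw [← Finset.sum_subset (Finset.subset_univ (cluster m t))]
  · exact Finset.sum_congr rfl fun i hi => by rw [if_pos hi]; rfl
  · intro i _ hi; rw [if_neg hi, zero_mul]

lemma sq_forest_error_le {prob : Fin p → ℝ} (hprob : ∀ j, 0 ≤ prob j) (hsum : ∑ j, prob j = 1)
    (X : Idx m → Fin p → ℝ) (j : Fin p) :
    (∑ i, forestWeight M prob (constBox p a b) (cluster m t) X x i * (X i j - x j)) ^ 2
      ≤ treeExp M prob fun θ => treeError t a b θ j x X ^ 2 := by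
  rw [forestWeight_sum]
  exact sq_treeExp_le hprob hsum _

/-- In a tree with an empty leaf the prediction is `0`, and otherwise the weights sum to `1`. -/
lemma sq_forest_bias_le {prob : Fin p → ℝ} (hprob : ∀ j, 0 ≤ prob j) (hsum : ∑ j, prob j = 1)
    (X : Idx m → Fin p → ℝ) (j : Fin p) :
    (∑ i, forestWeight M prob (constBox p a b) (cluster m t) X x i * X i j - x j) ^ 2
      ≤ treeExp M prob fun θ =>
        treeError t a b θ j x X ^ 2 + x j ^ 2 * emptyLeaf t a b θ x X := by
  rw [forestWeight_sum, ← treeExp_const (M := M) hsum (x j), sub_eq_add_neg, ← neg_one_mul,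
    ← treeExp_mul_left, ← treeExp_add]
  refine (sq_treeExp_le hprob hsum _).trans (treeExp_mono hprob fun θ => le_of_eq ?_)
  rw [treeExp_const hsum]
  unfold treeError emptyLeaf
  generalize (leaf (constBox p a b) θ x).toSet = A
  by_cases h : count (cluster m t) A X = 0
  · simp [h]
  · have h1 : ∑ i ∈ cluster m t, ind A (X i) / count (cluster m t) A X * x j = x j := by
      rw [← Finset.sum_mul, ← Finset.sum_div]
      change count (cluster m t) A X / count (cluster m t) A X * x j = x j
      rw [div_self h, one_mul]
    rw [if_neg h, mul_zero, add_zero]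
    simp only [mul_sub, Finset.sum_sub_distrib, h1]
    ring

end FixedPoint

/-! ### Averaging over the covariates and the test point -/

/-- Monotonicity of the integral in which the smaller function need not be measurable: if it is
not integrable, then its integral is `0`, which is no more than that of a nonnegative function. -/
lemma integral_le_of_ae_le {β : Type*} [MeasurableSpace β] {P : Measure β} {F G : β → ℝ}
    (hG : Integrable G P) (h0 : 0 ≤ᵐ[P] G) (h : F ≤ᵐ[P] G) : ∫ y, F y ∂P ≤ ∫ y, G y ∂P := by
  by_cases hF : Integrable F P
  · exact integral_mono_ae hF hG h
  · rw [integral_undef hF]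
    exact integral_nonneg_of_ae h0

lemma integral_testLaw_le {p : ℕ} {F : (Fin p → ℝ) → ℝ} {B : ℝ} (hB : 0 ≤ B)
    (h : ∀ t : Fin 2, ∃ G : (Fin p → ℝ) → ℝ, Integrable G (unifCube p t) ∧
      F ≤ᵐ[unifCube p t] G ∧ ∫ x, G x ∂(unifCube p t) ≤ B) :
    ∫ x, F x ∂(testLaw p) ≤ B := by
  by_cases hF : Integrable F (testLaw p)
  · unfold testLaw at hF ⊢
    have h0 := hF.left_of_add_measure
    have h1 := hF.right_of_add_measure
    have key : ∀ t : Fin 2, Integrable F ((1 / 2 : ENNReal) • unifCube p t) →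
        ∫ x, F x ∂((1 / 2 : ENNReal) • unifCube p t) ≤ B / 2 := by
      intro t ht
      obtain ⟨G, hG, hFG, hGB⟩ := h t
      have ht' : Integrable F (unifCube p t) :=
        (integrable_smul_measure (by simp) (by simp)).1 ht
      rw [integral_smul_measure]
      have := (integral_mono_ae ht' hG hFG).trans hGB
      simp only [one_div, ENNReal.toReal_inv, ENNReal.toReal_ofNat, smul_eq_mul]
      linarith
    rw [integral_add_measure h0 h1]
    linarith [key 0 h0, key 1 h1]
  · rwa [integral_undef hF]

/-- Average over the test point and the covariates of a bias that is controlled by the errors of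
the single trees. -/
lemma integral_integral_le {p m M : ℕ} (S : Finset (Fin p)) {a b : Fin 2 → ℝ} {L : ℝ}
    (hab : ∀ t, Admissible t (a t) (b t)) (hL : ∀ t, b t - a t = L)
    {prob : Fin p → ℝ} (hprob : ∀ j, 0 ≤ prob j) (hsum : ∑ j, prob j = 1)
    (hlarge : 2 ^ 72 * Real.exp (-(1 / 2 * (1 / 2 : ℝ) ^ M * m)) ≤ 1 / 72)
    {E : ℝ} (hE : 0 ≤ E) (F : (Fin p → ℝ) → (Idx m → Fin p → ℝ) → ℝ)
    (hF : ∀ t, ∀ x ∈ halfOpenCube p t, ∀ᵐ X ∂(dataLaw p m),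
      F x X ≤ ∑ j ∈ S, treeExp M prob fun θ =>
        treeError t (a t) (b t) θ j x X ^ 2 + E * emptyLeaf t (a t) (b t) θ x X) :
    ∫ x, ∫ X, F x X ∂(dataLaw p m) ∂(testLaw p)
      ≤ L ^ 2 / 9 * ∑ j ∈ S, (1 - 3 * prob j / 4) ^ M
        + S.card * E * Real.exp (-((1 / 2 : ℝ) ^ M * m)) := by
  set ex := Real.exp (-((1 / 2 : ℝ) ^ M * m)) with hex
  have hp1 : ∀ j, prob j ≤ 1 := fun j => by
    rw [← hsum]; exact Finset.single_le_sum (fun i _ => hprob i) (Finset.mem_univ j)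
  have hB : 0 ≤ L ^ 2 / 9 * ∑ j ∈ S, (1 - 3 * prob j / 4) ^ M + S.card * E * ex := by
    have : 0 ≤ ∑ j ∈ S, (1 - 3 * prob j / 4) ^ M :=
      Finset.sum_nonneg fun j _ => pow_nonneg (by linarith [hp1 j]) _
    positivity
  refine integral_testLaw_le hB fun t => ?_
  -- the square of the distance of the test point to the centre, and the variance of a tree
  let G : Fin p → (Fin M → Fin p) → (Fin p → ℝ) → ℝ := fun j θ x =>
    (centre (corner t) (corner t + 1 / 2) (cell (a t) (b t) (cuts θ j) (x j)) - x j) ^ 2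
      + (((b t - a t) / 2 ^ cuts θ j) ^ 2 / 36 + E * ex)
  have hsq : ∀ j (θ : Fin M → Fin p), Integrable (fun x : Fin p → ℝ =>
      (centre (corner t) (corner t + 1 / 2) (cell (a t) (b t) (cuts θ j) (x j)) - x j) ^ 2)
      (unifCube p t) := fun j θ =>
    integrable_comp_eval (μ := fun _ : Fin p => unifSide t) (i := j)
      (integrable_centre_cell_sq t (hab t).left (hab t).right (cuts θ j))
  have hGi : ∀ j θ, Integrable (G j θ) (unifCube p t) := fun j θ =>
    (hsq j θ).add (integrable_const _)
  refine ⟨fun x => ∑ j ∈ S, treeExp M prob fun θ => G j θ x,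
    integrable_finsetSum _ fun j _ => integrable_treeExp (hGi j), ?_, ?_⟩
  · filter_upwards [ae_mem_halfOpenCube p t] with x hx
    have hi : ∀ j (θ : Fin M → Fin p), Integrable (fun X : Idx m → Fin p → ℝ =>
        treeError t (a t) (b t) θ j x X ^ 2 + E * emptyLeaf t (a t) (b t) θ x X)
        (dataLaw p m) := fun j θ =>
      (integrable_sq_treeError (hab t) θ j hx).add ((integrable_emptyLeaf θ).const_mul E)
    refine (integral_le_of_ae_le (integrable_finsetSum _ fun j _ => integrable_treeExp (hi j))
      (ae_of_all _ fun X => ?_) (hF t x hx)).trans ?_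
    · refine Finset.sum_nonneg fun j _ => ?_
      rw [← treeExp_const (M := M) hsum 0]
      exact treeExp_mono hprob fun θ =>
        add_nonneg (sq_nonneg _) (mul_nonneg hE (emptyLeaf_nonneg θ X))
    · rw [integral_finsetSum _ fun j _ => integrable_treeExp (hi j)]
      refine Finset.sum_le_sum fun j _ => ?_
      rw [integral_treeExp (hi j)]
      refine treeExp_mono hprob fun θ => ?_
      rw [integral_add (integrable_sq_treeError (hab t) θ j hx)
        ((integrable_emptyLeaf θ).const_mul E), integral_const_mul]
      have h1 := integral_sq_treeError_le (hab t) θ j hx hlarge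
      have h2 := mul_le_mul_of_nonneg_left (integral_emptyLeaf_le (m := m) (hab t) θ hx) hE
      simp only [G]
      linarith
  · rw [integral_finsetSum _ fun j _ => integrable_treeExp (hGi j), Finset.mul_sum, mul_assoc,
      ← nsmul_eq_mul, ← Finset.sum_const, ← Finset.sum_add_distrib]
    refine Finset.sum_le_sum fun j _ => ?_
    rw [integral_treeExp (hGi j)]
    have h1 : ∀ θ, ∫ x, G j θ x ∂(unifCube p t) ≤ L ^ 2 / 9 * (1 / 4) ^ cuts θ j + E * ex := by
      intro θ
      simp only [G]
      rw [integral_add (hsq j θ) (integrable_const _)]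
      have h2 : ∫ x : Fin p → ℝ,
          (centre (corner t) (corner t + 1 / 2) (cell (a t) (b t) (cuts θ j) (x j)) - x j) ^ 2
            ∂(unifCube p t) ≤ ((b t - a t) / 2 ^ cuts θ j) ^ 2 / 12 := by
        have h3 := integral_centre_cell_sq_le t (hab t).left (hab t).right (cuts θ j)
        rwa [← integral_comp_eval (μ := fun _ : Fin p => unifSide t) (i := j)
          (integrable_centre_cell_sq t (hab t).left (hab t).right (cuts θ j)).1] at h3
      have h4 : ((b t - a t) / 2 ^ cuts θ j) ^ 2 = L ^ 2 * (1 / 4) ^ cuts θ j := by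
        rw [hL, div_pow, ← pow_mul, mul_comm _ 2, pow_mul, one_div, inv_pow]
        norm_num [div_eq_mul_inv]
      rw [h4] at h2 ⊢
      simp only [integral_const, probReal_univ, one_smul]
      linarith
    refine (treeExp_mono hprob h1).trans_eq ?_
    rw [treeExp_add, treeExp_mul_left, treeExp_pow_cuts hsum, treeExp_const hsum]
    ring

/-! ### Averaging over the coefficients and the noise -/

instance {p : ℕ} (S : Finset (Fin p)) : IsProbabilityMeasure (coefLaw S) := by
  unfold coefLaw; infer_instance

lemma memLp_coef {p : ℕ} (S : Finset (Fin p)) (c : S → ℝ) :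
    MemLp (fun β : S → ℝ => ∑ j, c j * β j) 2 (coefLaw S) :=
  memLp_finsetSum _ fun j _ =>
    ((memLp_id_gaussianReal (μ := 0) (v := 1) 2).comp_measurePreserving
      (measurePreserving_eval (fun _ : S => gaussianReal 0 1) j)).const_mul (c j)

/-- The coefficients are uncorrelated with unit variance. -/
lemma integral_sq_coef {p : ℕ} (S : Finset (Fin p)) (c : S → ℝ) :
    ∫ β, (∑ j, c j * β j) ^ 2 ∂(coefLaw S) = ∑ j, c j ^ 2 := by
  have hi : ∀ j : S, Integrable (fun β : S → ℝ => c j * β j) (coefLaw S) := fun j =>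
    (((memLp_id_gaussianReal (μ := 0) (v := 1) 2).comp_measurePreserving
      (measurePreserving_eval (fun _ : S => gaussianReal 0 1) j)).integrable
        (by norm_num)).const_mul (c j)
  have h0 : ∫ β, ∑ j, c j * β j ∂(coefLaw S) = 0 := by
    rw [integral_finsetSum _ fun j _ => hi j]
    refine Finset.sum_eq_zero fun j _ => ?_
    rw [integral_const_mul]
    have : ∫ β : S → ℝ, β j ∂(coefLaw S) = 0 := by
      have := integral_comp_eval (μ := fun _ : S => gaussianReal 0 1) (i := j) (f := fun y : ℝ => y)
        measurable_id.aestronglyMeasurable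
      rw [integral_id_gaussianReal] at this
      exact this
    rw [this, mul_zero]
  rw [← variance_of_integral_eq_zero (memLp_coef S c).aestronglyMeasurable.aemeasurable h0]
  have h1 := variance_sum_pi (μ := fun _ : S => gaussianReal 0 1) (X := fun j y => c j * y)
    fun j => (memLp_id_gaussianReal (μ := 0) (v := 1) 2).const_mul (c j)
  have h2 : ∀ j, Var[fun y => c j * y; gaussianReal 0 1] = c j ^ 2 := by
    intro j
    rw [variance_const_mul]
    rw [show (fun y : ℝ => y) = id from rfl, variance_id_gaussianReal]
    simp
  rw [Finset.sum_congr rfl fun j _ => h2 j] at h1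
  rw [← h1]
  congr 1
  funext β
  simp

/-- Dropping the diagonal of the double sum only makes it smaller. -/
lemma sum_sum_erase_le_sq {ι : Type*} [Fintype ι] [DecidableEq ι] (z : ι → ℝ) :
    ∑ i, ∑ l ∈ Finset.univ.erase i, z i * z l ≤ (∑ i, z i) ^ 2 := by
  rw [sq, Finset.sum_mul_sum]
  refine Finset.sum_le_sum fun i _ => ?_
  rw [← Finset.sum_erase_add _ _ (Finset.mem_univ i)]
  linarith [mul_self_nonneg (z i)]

lemma integral_leading_le {p : ℕ} {ι : Type*} [Fintype ι] [DecidableEq ι] (S : Finset (Fin p))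
    (w : ι → ℝ) (X : ι → Fin p → ℝ) (x : Fin p → ℝ) :
    ∫ β, ∑ i, ∑ l ∈ Finset.univ.erase i,
      (w i * (regFun S β (X i) - regFun S β x)) * (w l * (regFun S β (X l) - regFun S β x))
        ∂(coefLaw S)
      ≤ ∑ j ∈ S, (∑ i, w i * (X i j - x j)) ^ 2 := by
  have h1 : ∀ β : S → ℝ, ∑ i, w i * (regFun S β (X i) - regFun S β x)
      = ∑ j : S, (∑ i, w i * (X i j - x j)) * β j := by
    intro β
    simp only [regFun, ← Finset.sum_sub_distrib, Finset.mul_sum, Finset.sum_mul]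
    rw [Finset.sum_comm]
    exact Finset.sum_congr rfl fun _ _ => Finset.sum_congr rfl fun _ _ => by ring
  refine (integral_le_of_ae_le (G := fun β => (∑ j : S, (∑ i, w i * (X i j - x j)) * β j) ^ 2)
    (memLp_coef S _).integrable_sq (ae_of_all _ fun β => sq_nonneg _)
    (ae_of_all _ fun β => ?_)).trans_eq ?_
  · simp only [← h1]
    exact sum_sum_erase_le_sq _
  · rw [integral_sq_coef, ← Finset.sum_coe_sort S]

lemma integral_bias_eq {p : ℕ} {ι : Type*} [Fintype ι] (S : Finset (Fin p)) (ν : Measure ℝ)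
    [IsProbabilityMeasure ν] (hν : Integrable (fun e : ℝ => e) ν) (hν0 : ∫ e, e ∂ν = 0)
    (w : ι → ℝ) (X : ι → Fin p → ℝ) (x : Fin p → ℝ) :
    ∫ β, ((∫ ε : ι → ℝ, ∑ i, (regFun S β (X i) + ε i) * w i ∂(Measure.pi fun _ => ν))
      - regFun S β x) ^ 2 ∂(coefLaw S)
      = ∑ j ∈ S, (∑ i, w i * X i j - x j) ^ 2 := by
  have hε : ∀ i, Integrable (fun ε : ι → ℝ => ε i) (Measure.pi fun _ => ν) := fun i =>
    integrable_comp_eval (μ := fun _ : ι => ν) (i := i) hν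
  have h1 : ∀ β : S → ℝ,
      (∫ ε : ι → ℝ, ∑ i, (regFun S β (X i) + ε i) * w i ∂(Measure.pi fun _ => ν))
        - regFun S β x = ∑ j : S, (∑ i, w i * X i j - x j) * β j := by
    intro β
    have hi : ∀ i, Integrable (fun ε : ι → ℝ => (regFun S β (X i) + ε i) * w i)
        (Measure.pi fun _ => ν) := fun i => ((integrable_const _).add (hε i)).mul_const _
    rw [integral_finsetSum _ fun i _ => hi i]
    have h2 : ∀ i, ∫ ε : ι → ℝ, (regFun S β (X i) + ε i) * w i ∂(Measure.pi fun _ => ν)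
        = regFun S β (X i) * w i := by
      intro i
      rw [integral_mul_const, integral_add (integrable_const _) (hε i)]
      have h3 := integral_comp_eval (μ := fun _ : ι => ν) (i := i) (f := fun y : ℝ => y)
        measurable_id.aestronglyMeasurable
      simp only [hν0] at h3
      simp [h3]
    rw [Finset.sum_congr rfl fun i _ => h2 i]
    simp only [regFun, sub_mul, Finset.sum_sub_distrib, Finset.sum_mul]
    rw [Finset.sum_comm]
    congr 1
    exact Finset.sum_congr rfl fun _ _ => Finset.sum_congr rfl fun _ _ => by ring
  simp only [h1]
  rw [integral_sq_coef, ← Finset.sum_coe_sort S]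

/-! ### Learners whose weights are those of one forest per cluster -/

section Learner

variable {p m M : ℕ} {S : Finset (Fin p)} {a b : Fin 2 → ℝ} {L : ℝ} {prob : Fin p → ℝ}
  {w : (Idx m → Fin p → ℝ) → (Fin p → ℝ) → Idx m → ℝ}

lemma leadingTerm_le (hab : ∀ t, Admissible t (a t) (b t)) (hL : ∀ t, b t - a t = L)
    (hprob : ∀ j, 0 ≤ prob j) (hsum : ∑ j, prob j = 1)
    (hlarge : 2 ^ 72 * Real.exp (-(1 / 2 * (1 / 2 : ℝ) ^ M * m)) ≤ 1 / 72)
    (hw : ∀ t, ∀ x ∈ halfOpenCube p t, ∀ᵐ X ∂(dataLaw p m), ∀ i,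
      w X x i = forestWeight M prob (constBox p (a t) (b t)) (cluster m t) X x i) :
    leadingTerm S w ≤ L ^ 2 / 9 * ∑ j ∈ S, (1 - 3 * prob j / 4) ^ M := by
  have h := integral_integral_le (m := m) S hab hL hprob hsum hlarge le_rfl
    (fun x X => ∫ β, ∑ i, ∑ l ∈ Finset.univ.erase i,
      (w X x i * (regFun S β (X i) - regFun S β x)) *
        (w X x l * (regFun S β (X l) - regFun S β x)) ∂(coefLaw S)) (by
    intro t x hx
    filter_upwards [hw t x hx] with X hX
    refine (integral_leading_le S (w X x) X x).trans (Finset.sum_le_sum fun j _ => ?_)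
    simp only [hX, zero_mul, add_zero]
    exact sq_forest_error_le hprob hsum X j)
  simpa [leadingTerm] using h

lemma squaredBias_le (hab : ∀ t, Admissible t (a t) (b t)) (hL : ∀ t, b t - a t = L)
    (hprob : ∀ j, 0 ≤ prob j) (hsum : ∑ j, prob j = 1)
    (hlarge : 2 ^ 72 * Real.exp (-(1 / 2 * (1 / 2 : ℝ) ^ M * m)) ≤ 1 / 72)
    (hw : ∀ t, ∀ x ∈ halfOpenCube p t, ∀ᵐ X ∂(dataLaw p m), ∀ i,
      w X x i = forestWeight M prob (constBox p (a t) (b t)) (cluster m t) X x i)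
    (ν : Measure ℝ) [IsProbabilityMeasure ν] (hν : Integrable (fun e : ℝ => e) ν)
    (hν0 : ∫ e, e ∂ν = 0) :
    squaredBias S ν w ≤ L ^ 2 / 9 * ∑ j ∈ S, (1 - 3 * prob j / 4) ^ M
      + S.card * (9 / 4) * Real.exp (-((1 / 2 : ℝ) ^ M * m)) := by
  refine integral_integral_le (m := m) S hab hL hprob hsum hlarge (by norm_num)
    (fun x X => ∫ β,
      ((∫ ε : Idx m → ℝ, ∑ i, (regFun S β (X i) + ε i) * w X x i ∂(Measure.pi fun _ => ν))
        - regFun S β x) ^ 2 ∂(coefLaw S)) ?_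
  intro t x hx
  filter_upwards [hw t x hx] with X hX
  rw [integral_bias_eq S ν hν hν0]
  refine Finset.sum_le_sum fun j _ => ?_
  simp only [hX]
  refine (sq_forest_bias_le hprob hsum X j).trans (treeExp_mono hprob fun θ => ?_)
  have hxj : x j ^ 2 ≤ 9 / 4 := by
    have h1 := hx j
    have hc : 0 ≤ corner t ∧ corner t ≤ 1 := by fin_cases t <;> simp [corner]
    nlinarith [h1.1, h1.2]
  have := mul_le_mul_of_nonneg_right hxj (emptyLeaf_nonneg (t := t) (a := a t) (b := b t)
    (x := x) θ X)
  linarith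

end Learner

/-! ### The weights of the Ensemble and of the Merged learner -/

lemma mem_cube_iff {p : ℕ} (j : Fin p) {s t : Fin 2} {x : Fin p → ℝ} (hx : x ∈ halfOpenCube p t) :
    x ∈ cube p s ↔ s = t := by
  constructor
  · intro h
    have h1 := h j
    have h2 := hx j
    fin_cases s <;> fin_cases t <;> simp [corner] at h1 h2 ⊢ <;> linarith
  · rintro rfl k
    exact Set.Ico_subset_Icc_self (hx k)

lemma ensembleWeight_eq {p m M : ℕ} (j : Fin p) (prob : Fin p → ℝ) {t : Fin 2} {x : Fin p → ℝ}
    (hx : x ∈ halfOpenCube p t) (X : Idx m → Fin p → ℝ) (i : Idx m) :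
    ensembleWeight M prob X x i
      = forestWeight M prob (constBox p (corner t) (corner t + 1 / 2)) (cluster m t) X x i := by
  unfold ensembleWeight
  rw [Finset.sum_eq_single t]
  · rw [ind_of_mem ((mem_cube_iff j hx).2 rfl), one_mul]
    rfl
  · intro s _ hs
    rw [ind_of_notMem (fun h => hs ((mem_cube_iff j hx).1 h)), zero_mul]
  · simp

lemma ownCubeRoot_eq {p : ℕ} (j : Fin p) {t : Fin 2} {x : Fin p → ℝ} (hx : x ∈ halfOpenCube p t) :
    ownCubeRoot p x = constBox p (corner t) (corner t + 1 / 2) := by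
  unfold ownCubeRoot
  simp only [mem_cube_iff j hx]
  fin_cases t
  · exact if_pos rfl
  · exact if_neg (by decide)

/-- Training points that share no leaf with the test point do not influence the weights. -/
lemma forestWeight_univ_eq {p m M : ℕ} (prob : Fin p → ℝ) (R : Box p) (t : Fin 2)
    {x : Fin p → ℝ} {X : Idx m → Fin p → ℝ}
    (hsep : ∀ i, i.1 ≠ t → ∀ θ : Fin M → Fin p, X i ∉ (leaf R θ x).toSet) (i : Idx m) :
    forestWeight M prob R Finset.univ X x i = forestWeight M prob R (cluster m t) X x i := by
  unfold forestWeight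
  congr 1
  funext θ
  have hsum : ∑ l, ind (leaf R θ x).toSet (X l)
      = ∑ l ∈ cluster m t, ind (leaf R θ x).toSet (X l) := by
    refine (Finset.sum_subset (Finset.subset_univ _) fun l _ hl => ?_).symm
    exact ind_of_notMem (hsep l (fun h => hl (by simp [cluster, h])) θ)
  rw [if_pos (Finset.mem_univ i), hsum]
  by_cases hi : i ∈ cluster m t
  · rw [if_pos hi]
  · rw [if_neg hi, ind_of_notMem (hsep i (fun h => hi (by simp [cluster, h])) θ), zero_div]

lemma notMem_leaf_own {p M : ℕ} (j : Fin p) {s t : Fin 2} (hst : s ≠ t) {x y : Fin p → ℝ}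
    (hy : y ∈ halfOpenCube p s) (θ : Fin M → Fin p) :
    y ∉ (leaf (constBox p (corner t) (corner t + 1 / 2)) θ x).toSet := by
  intro h
  have h1 := h j
  have h2 := leaf_side (constBox p (corner t) (corner t + 1 / 2)) θ x j
  have h3 := cell_subset (a := corner t) (b := corner t + 1 / 2) (by linarith) (cuts θ j) (x j)
  have h4 := hy j
  simp only [Prod.ext_iff] at h2
  change _ = (cell (corner t) (corner t + 1 / 2) (cuts θ j) (x j)).1 ∧
    _ = (cell (corner t) (corner t + 1 / 2) (cuts θ j) (x j)).2 at h2
  rw [h2.1, h2.2] at h1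
  have h5 : y j ∈ Set.Ico (corner t) (corner t + 1 / 2) :=
    ⟨h3.1.trans h1.1, h1.2.trans_le h3.2⟩
  fin_cases s <;> fin_cases t <;> simp [corner] at h4 h5 hst <;> linarith

/-- The first cut of a side of `[0, 3/2]` separates the clusters. -/
lemma notMem_leaf_range {p M : ℕ} (hM : M ≠ 0) {s t : Fin 2} (hst : s ≠ t) {x y : Fin p → ℝ}
    (hx : x ∈ halfOpenCube p t) (hy : y ∈ halfOpenCube p s) (θ : Fin M → Fin p) :
    y ∉ (leaf (constBox p 0 (3 / 2)) θ x).toSet := by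
  intro h
  obtain ⟨j, hj⟩ : ∃ j, cuts θ j ≠ 0 := by
    by_contra hcon
    push Not at hcon
    exact hM (by rw [← sum_cuts θ]; simp [hcon])
  obtain ⟨K, hK⟩ := Nat.exists_eq_succ_of_ne_zero hj
  have h1 := h j
  have h2 := leaf_side (constBox p 0 (3 / 2)) θ x j
  simp only [Prod.ext_iff] at h2
  change _ = (cell 0 (3 / 2) (cuts θ j) (x j)).1 ∧ _ = (cell 0 (3 / 2) (cuts θ j) (x j)).2 at h2
  rw [h2.1, h2.2, hK, Nat.succ_eq_add_one, cell_succ] at h1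
  have h3 := hx j
  have h4 := hy j
  have h5 := cell_subset (a := 0) (b := (0 + 3 / 2) / 2) (by norm_num) K (x j)
  have h6 := cell_subset (a := (0 + 3 / 2) / 2) (b := 3 / 2) (by norm_num) K (x j)
  split_ifs at h1 with hlt
  · fin_cases s <;> fin_cases t <;> simp [corner] at h3 h4 hst <;> linarith [h1.2]
  · fin_cases s <;> fin_cases t <;> simp [corner] at h3 h4 hst <;> linarith [h1.1]

lemma mergedWeight_ownCube_eq {p m M : ℕ} (j : Fin p) (prob : Fin p → ℝ) {t : Fin 2}
    {x : Fin p → ℝ} (hx : x ∈ halfOpenCube p t) :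
    ∀ᵐ X ∂(dataLaw p m), ∀ i, mergedWeight M prob (ownCubeRoot p) X x i
      = forestWeight M prob (constBox p (corner t) (corner t + 1 / 2)) (cluster m t) X x i := by
  filter_upwards [ae_data_mem_halfOpenCube p m] with X hX i
  unfold mergedWeight
  rw [ownCubeRoot_eq j hx]
  exact forestWeight_univ_eq prob _ t (fun i hi θ => notMem_leaf_own j hi (hX i) θ) i

lemma mergedWeight_range_eq {p m M : ℕ} (hM : M ≠ 0) (prob : Fin p → ℝ) {t : Fin 2}
    {x : Fin p → ℝ} (hx : x ∈ halfOpenCube p t) :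
    ∀ᵐ X ∂(dataLaw p m), ∀ i, mergedWeight M prob (rangeRoot p) X x i
      = forestWeight M prob (constBox p 0 (3 / 2)) (cluster m t) X x i := by
  filter_upwards [ae_data_mem_halfOpenCube p m] with X hX i
  exact forestWeight_univ_eq prob (constBox p 0 (3 / 2)) t
    (fun i hi θ => notMem_leaf_range hM hi hx (hX i) θ) i

/-! ### Depth and rate -/

lemma depth_ne_zero {k : ℝ} (hk : 2 < k) : depth k ≠ 0 :=
  (Nat.ceil_pos.2 (Real.logb_pos (by norm_num) (by linarith))).ne'

lemma half_pow_depth_ge {k : ℝ} (hk : 2 < k) : 1 / (2 * k) ≤ (1 / 2 : ℝ) ^ depth k := by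
  have h0 : 0 ≤ Real.logb 2 k := Real.logb_nonneg (by norm_num) (by linarith)
  have h1 : (depth k : ℝ) ≤ Real.logb 2 k + 1 := (Nat.ceil_lt_add_one h0).le
  have h2 : (2 : ℝ) ^ depth k ≤ 2 * k := by
    calc (2 : ℝ) ^ depth k = (2 : ℝ) ^ (depth k : ℝ) := (Real.rpow_natCast 2 _).symm
      _ ≤ (2 : ℝ) ^ (Real.logb 2 k + 1) := Real.rpow_le_rpow_of_exponent_le (by norm_num) h1
      _ = 2 * k := by
        rw [Real.rpow_add (by norm_num), Real.rpow_logb (by norm_num) (by norm_num) (by linarith),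
          Real.rpow_one, mul_comm]
  rw [div_pow, one_pow]
  exact one_div_le_one_div_of_le (by positivity) h2

lemma pow_depth_le_rate {k q r : ℝ} (hk : 2 < k) (hqr : q ≤ r) (hr0 : 0 ≤ r) (hr : r ≤ 1) :
    (1 - 3 * r / 4) ^ depth k ≤ rate k q := by
  have hy : 0 < 1 - 3 * r / 4 := by linarith
  calc (1 - 3 * r / 4) ^ depth k = (1 - 3 * r / 4) ^ (depth k : ℝ) := (Real.rpow_natCast _ _).symm
    _ ≤ (1 - 3 * r / 4) ^ Real.logb 2 k :=
        Real.rpow_le_rpow_of_exponent_ge hy (by linarith) (Nat.le_ceil _)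
    _ = k ^ Real.logb 2 (1 - 3 * r / 4) := by
        conv_lhs => rw [← Real.rpow_logb (b := 2) (by norm_num) (by norm_num) hy]
        conv_rhs =>
          rw [← Real.rpow_logb (b := 2) (x := k) (by norm_num) (by norm_num) (by linarith)]
        rw [← Real.rpow_mul (by norm_num), ← Real.rpow_mul (by norm_num), mul_comm]
    _ ≤ rate k q := by
        refine Real.rpow_le_rpow_of_exponent_le (by linarith) ?_
        exact Real.logb_le_logb_of_le (by norm_num) hy (by linarith)

/-- In the long run so many points are expected in each leaf that the variance of a tree is small
compared with the squared side of the leaf. -/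
lemma eventually_many_points {k : ℕ → ℝ} (hk : ∀ m, 2 < k m)
    (hkn : Tendsto (fun m : ℕ => k m / (2 * (m : ℝ))) atTop (𝓝 0)) :
    ∀ᶠ m : ℕ in atTop,
      2 ^ 72 * Real.exp (-(1 / 2 * (1 / 2 : ℝ) ^ depth (k m) * m)) ≤ 1 / 72 := by
  set T := Real.log (72 * 2 ^ 72) with hT
  have hT0 : 0 < T := Real.log_pos (by norm_num)
  filter_upwards [hkn.eventually_lt_const (show 0 < 1 / (8 * T) by positivity),
    eventually_gt_atTop 0] with m hm hm0
  have hm0' : (0 : ℝ) < m := by exact_mod_cast hm0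
  have hk0 : 0 < k m := by linarith [hk m]
  have h1 : T ≤ 1 / 2 * (1 / 2 : ℝ) ^ depth (k m) * m := by
    calc T ≤ 1 / 2 * (1 / (2 * k m)) * m := by
          rw [div_lt_div_iff₀ (by positivity) (by positivity)] at hm
          have : 1 / 2 * (1 / (2 * k m)) * m = m / (4 * k m) := by field_simp; norm_num
          rw [this, le_div_iff₀ (by positivity)]
          linarith
      _ ≤ _ := by
          have := half_pow_depth_ge (hk m)
          gcongr
  calc 2 ^ 72 * Real.exp (-(1 / 2 * (1 / 2 : ℝ) ^ depth (k m) * m))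
      ≤ 2 ^ 72 * Real.exp (-T) := by gcongr
    _ = 1 / 72 := by
      rw [Real.exp_neg, hT, Real.exp_log (by norm_num)]
      norm_num

lemma exp_empty_le {k : ℝ} (hk : 2 < k) (m : ℕ) :
    Real.exp (-((1 / 2 : ℝ) ^ depth k * m)) ≤ Real.exp (-(2 * (m : ℝ)) / (8 * k)) := by
  have hk0 : 0 < k := by linarith
  rw [Real.exp_le_exp, neg_div, neg_le_neg_iff]
  calc 2 * (m : ℝ) / (8 * k) ≤ 1 / (2 * k) * m := by
        rw [div_le_iff₀ (by positivity)]
        have : 1 / (2 * k) * m * (8 * k) = 4 * m := by field_simp; ring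
        rw [this]
        linarith [Nat.cast_nonneg (α := ℝ) m]
    _ ≤ _ := mul_le_mul_of_nonneg_right (half_pow_depth_ge hk) (Nat.cast_nonneg m)

end CenteredForest

theorem theorem3 (p : ℕ) (S : Finset (Fin p)) (hS : S.Nonempty)
    -- law of the noise: mean zero, finite variance
    (ν : Measure ℝ) [IsProbabilityMeasure ν] (hν : MemLp (fun e : ℝ => e) 2 ν)
    (hν0 : ∫ e, e ∂ν = 0)
    -- all sequences are indexed by the common cluster size `m`; the sample size is `n = 2 m`
    (k : ℕ → ℝ) (hk : ∀ m, 2 < k m)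
    (prob ξ : ℕ → Fin p → ℝ)
    (hprob : ∀ m j, 0 ≤ prob m j) (hsum : ∀ m, ∑ j, prob m j = 1)
    (hstrong : ∀ m, ∀ j ∈ S, prob m j = 1 / (S.card : ℝ) * (1 + ξ m j))
    (hweak : ∀ m, ∀ j ∉ S, prob m j = ξ m j)
    (hξ : ∀ j, Tendsto (fun m => ξ m j) atTop (𝓝 0))
    (pn : ℕ → ℝ) (hpn : ∀ m, pn m = 1 / (S.card : ℝ) * (1 + ⨅ j, ξ m j))
    (hlog : ∀ j, Tendsto (fun m => prob m j * Real.log (k m)) atTop atTop)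
    (hkn : Tendsto (fun m : ℕ => k m / (2 * (m : ℝ))) atTop (𝓝 0)) :
    -- (i) Ensemble
    (∃ r : ℕ → ℝ, Tendsto r atTop (𝓝 0) ∧ ∀ᶠ m in atTop,
      leadingTerm (m := m) S (ensembleWeight (depth (k m)) (prob m))
        ≤ (S.card : ℝ) / 8 * rate (k m) (pn m) * (1 + r m)) ∧
    (∃ r : ℕ → ℝ, ∃ C : ℝ, Tendsto r atTop (𝓝 0) ∧ ∀ᶠ m in atTop,
      squaredBias (m := m) S ν (ensembleWeight (depth (k m)) (prob m))
        ≤ (S.card : ℝ) / 8 * rate (k m) (pn m) * (1 + r m)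
          + C * Real.exp (-(2 * (m : ℝ)) / (8 * k m))) ∧
    -- (ii) Merged, for both ways of growing its trees
    (∀ root : (Fin p → ℝ) → Box p, root = ownCubeRoot p ∨ root = rangeRoot p →
      (∃ r : ℕ → ℝ, Tendsto r atTop (𝓝 0) ∧ ∀ᶠ m in atTop,
        leadingTerm (m := m) S (mergedWeight (depth (k m)) (prob m) root)
          ≤ (S.card : ℝ) / 4 * rate (k m) (pn m) * (1 + r m)) ∧
      (∃ r : ℕ → ℝ, ∃ C : ℝ, Tendsto r atTop (𝓝 0) ∧ ∀ᶠ m in atTop,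
        squaredBias (m := m) S ν (mergedWeight (depth (k m)) (prob m) root)
          ≤ (S.card : ℝ) / 4 * rate (k m) (pn m) * (1 + r m)
            + C * Real.exp (-(2 * (m : ℝ)) / (8 * k m)))) := by
  obtain ⟨j₀, hj₀⟩ := hS
  have hcard : (0 : ℝ) < S.card := by exact_mod_cast Finset.card_pos.2 ⟨j₀, hj₀⟩
  have hν1 : Integrable (fun e : ℝ => e) ν := hν.integrable (by norm_num)
  have hp1 : ∀ m j, prob m j ≤ 1 := fun m j => by
    rw [← hsum m]
    exact Finset.single_le_sum (fun i _ => hprob m i) (Finset.mem_univ j)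
  have hpn_le : ∀ m, ∀ j ∈ S, pn m ≤ prob m j := fun m j hj => by
    rw [hpn, hstrong m j hj]
    have : ⨅ i, ξ m i ≤ ξ m j := ciInf_le (Set.finite_range _).bddBelow j
    gcongr
  have hrate0 : ∀ m, 0 ≤ rate (k m) (pn m) := fun m =>
    Real.rpow_nonneg (by linarith [hk m]) _
  have hrate : ∀ m, ∑ j ∈ S, (1 - 3 * prob m j / 4) ^ depth (k m) ≤ S.card * rate (k m) (pn m) :=
    fun m => by
      rw [← nsmul_eq_mul]
      exact Finset.sum_le_card_nsmul _ _ _ fun j hj =>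
        pow_depth_le_rate (hk m) (hpn_le m j hj) (hprob m j) (hp1 m j)
  have hmany := eventually_many_points hk hkn
  -- a forest grown from cubes of side `L` has a bias of order `L ^ 2 / 9`, and the error terms
  -- `o(1)` are not needed
  have main : ∀ (a b : Fin 2 → ℝ) (L c : ℝ), (∀ t, Admissible t (a t) (b t)) →
      (∀ t, b t - a t = L) → L ^ 2 / 9 ≤ c →
      ∀ w : (m : ℕ) → (Idx m → Fin p → ℝ) → (Fin p → ℝ) → Idx m → ℝ,
      (∀ m t, ∀ x ∈ halfOpenCube p t, ∀ᵐ X ∂(dataLaw p m), ∀ i, w m X x i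
        = forestWeight (depth (k m)) (prob m) (constBox p (a t) (b t)) (cluster m t) X x i) →
      (∃ r : ℕ → ℝ, Tendsto r atTop (𝓝 0) ∧ ∀ᶠ m in atTop,
        leadingTerm S (w m) ≤ S.card * c * rate (k m) (pn m) * (1 + r m)) ∧
      (∃ r : ℕ → ℝ, ∃ C : ℝ, Tendsto r atTop (𝓝 0) ∧ ∀ᶠ m in atTop,
        squaredBias S ν (w m) ≤ S.card * c * rate (k m) (pn m) * (1 + r m)
          + C * Real.exp (-(2 * (m : ℝ)) / (8 * k m))) := by
    intro a b L c hab hL hc w hw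
    have hbound : ∀ m, L ^ 2 / 9 * ∑ j ∈ S, (1 - 3 * prob m j / 4) ^ depth (k m)
        ≤ S.card * c * rate (k m) (pn m) * (1 + 0) := fun m => by
      calc L ^ 2 / 9 * ∑ j ∈ S, (1 - 3 * prob m j / 4) ^ depth (k m)
          ≤ L ^ 2 / 9 * (S.card * rate (k m) (pn m)) :=
            mul_le_mul_of_nonneg_left (hrate m) (by positivity)
        _ ≤ c * (S.card * rate (k m) (pn m)) :=
            mul_le_mul_of_nonneg_right hc (mul_nonneg hcard.le (hrate0 m))
        _ = _ := by ring
    refine ⟨⟨fun _ => 0, tendsto_const_nhds, ?_⟩,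
      ⟨fun _ => 0, S.card * (9 / 4), tendsto_const_nhds, ?_⟩⟩
    · filter_upwards [hmany] with m hm
      exact (leadingTerm_le hab hL (hprob m) (hsum m) hm (hw m)).trans (hbound m)
    · filter_upwards [hmany] with m hm
      refine (squaredBias_le hab hL (hprob m) (hsum m) hm (hw m) ν hν1 hν0).trans ?_
      exact add_le_add (hbound m)
        (mul_le_mul_of_nonneg_left (exp_empty_le (hk m) m) (by positivity))
  have hown : ∀ t : Fin 2, corner t + 1 / 2 - corner t = 1 / 2 := fun t => by ring
  have e8 : (S.card : ℝ) / 8 = S.card * (1 / 8) := by ring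
  have e4 : (S.card : ℝ) / 4 = S.card * (1 / 4) := by ring
  simp only [e8, e4]
  have hens := main corner (fun t => corner t + 1 / 2) (1 / 2) (1 / 8) admissible_own hown
    (by norm_num) (fun m => ensembleWeight (depth (k m)) (prob m))
    fun m t x hx => ae_of_all _ fun X i => ensembleWeight_eq j₀ (prob m) hx X i
  refine ⟨hens.1, hens.2, ?_⟩
  rintro root (rfl | rfl)
  · exact main corner (fun t => corner t + 1 / 2) (1 / 2) (1 / 4) admissible_own hown
      (by norm_num) (fun m => mergedWeight (depth (k m)) (prob m) (ownCubeRoot p))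
      fun m t x hx => mergedWeight_ownCube_eq j₀ (prob m) hx
  · exact main (fun _ => 0) (fun _ => 3 / 2) (3 / 2) (1 / 4) admissible_range
      (fun _ => sub_zero _) (by norm_num)
      (fun m => mergedWeight (depth (k m)) (prob m) (rangeRoot p))
      fun m t x hx => mergedWeight_range_eq (depth_ne_zero (hk m)) (prob m) hx
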